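/- Proposition 2.5 (Douglas criterion for conformally related Randers metrics). Let $M$ be a smooth (Hausdorff, boundaryless) manifold of dimension $n$, let $g$ be a smooth Riemannian metric on $M$, put $\alpha(x,y)=\sqrt{g_x(y,y)}$, and let $\beta$ be a smooth 1-form on $M$ with $\|\beta\|_\alpha<1$ at every point. Let $F=\alpha+\beta$ be the corresponding Randers metric, and let $X$ be the vector field with $\beta(v)=g(X,v)$ for all tangent vectors $v$. Let $f:M\to\mathbb{R}$ be smooth and let $\tilde F=e^{f}F$. Then $\tilde F$ is a Finsler metric of Douglas type if and only if $$d\beta(Y,Z)+(Yf)\,g(X,Z)-(Zf)\,g(X,Y)=0$$ for all smooth vector fields $Y,Z$ on $M$, where $d\beta(Y,Z)=Y(\beta(Z))-Z(\beta(Y))-\beta([Y,Z])$. Here a Finsler metric $\tilde F:TM\to\mathbb{R}$ (smooth off the zero section, positively homogeneous of degree one and positive on nonzero vectors, with positive definite fundamental tensor) is of Douglas type if its Douglas tensor vanishes, that is, if in all local coordinates $(x^i)$ of $M$, with induced coordinates $(x^i,y^i)$ of $TM$, and for all $i,j,k,l$ and $y\neq0$, $$\frac{\partial^3}{\partial y^j\partial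 y^k\partial y^l}\Big(G^i-\frac{1}{n+1}\,\frac{\partial G^m}{\partial y^m}\,y^i\Big)=0,$$ where $$G^i=\tfrac14\,\tilde g^{il}\Big(\frac{\partial^2 \tilde F^2}{\partial x^k\partial y^l}\,y^k-\frac{\partial \tilde F^2}{\partial x^l}\Big),\qquad \tilde g_{ij}=\tfrac12\,\frac{\partial^2\tilde F^2}{\partial y^i\partial y^j},$$ $(\tilde g^{ij})$ is the inverse matrix of $(\tilde g_{ij})$, and repeated indices are summed. -/

import Mathlib

open scoped Manifold ContDiff
open Bundle

noncomputable section

namespace FinslerDouglas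

section Coordinates

variable {n : ℕ}

/-- The partial derivative `∂h/∂uⁱ` at `u` of a function `h` on `ℝⁿ`. -/
def partialD (i : Fin n) (h : EuclideanSpace ℝ (Fin n) → ℝ) (u : EuclideanSpace ℝ (Fin n)) : ℝ :=
  fderiv ℝ h u (EuclideanSpace.single i 1)

/-- For a function `L u y` of a position `u` and a velocity `y`, the fundamental tensor
`g_{ij}(u, y) = (1/2) ∂²(L²)/∂yⁱ∂yʲ`. -/
def fundamentalMatrix (L : EuclideanSpace ℝ (Fin n) → EuclideanSpace ℝ (Fin n) → ℝ)
    (u y : EuclideanSpace ℝ (Fin n)) : Matrix (Fin n) (Fin n) ℝ :=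
  Matrix.of fun i j => (1 / 2) * partialD i (partialD j fun w => L u w ^ 2) y

/-- The spray coefficients
`Gⁱ(u, y) = (1/4) gⁱˡ ( yᵏ ∂²(L²)/∂uᵏ∂yˡ - ∂(L²)/∂uˡ )`. -/
def sprayCoeff (L : EuclideanSpace ℝ (Fin n) → EuclideanSpace ℝ (Fin n) → ℝ)
    (u : EuclideanSpace ℝ (Fin n)) (i : Fin n) (y : EuclideanSpace ℝ (Fin n)) : ℝ :=
  (1 / 4) * ∑ l : Fin n, (fundamentalMatrix L u y)⁻¹ i l *
    ((∑ k : Fin n, y k * partialD k (fun x => partialD l (fun w => L x w ^ 2) y) u)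
      - partialD l (fun x => L x y ^ 2) u)

/-- The components of the Douglas tensor
`Dⁱ_{jkl}(u, y) = ∂³/∂yʲ∂yᵏ∂yˡ ( Gⁱ - (1/(n+1)) (∂Gᵐ/∂yᵐ) yⁱ )`. -/
def douglasTensor (L : EuclideanSpace ℝ (Fin n) → EuclideanSpace ℝ (Fin n) → ℝ)
    (u : EuclideanSpace ℝ (Fin n)) (i j k l : Fin n) (y : EuclideanSpace ℝ (Fin n)) : ℝ :=
  partialD j (partialD k (partialD l fun w =>
    sprayCoeff L u i w
      - (1 / ((n : ℝ) + 1)) * (∑ m : Fin n, partialD m (sprayCoeff L u m) w) * w i)) y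

end Coordinates

section Manifold

variable {n : ℕ} {M : Type*} [TopologicalSpace M] [ChartedSpace (EuclideanSpace ℝ (Fin n)) M]

/-- The derivative `Y h` of a function `h` along a vector field `Y`. -/
def dirDeriv (Y : (x : M) → TangentSpace (𝓡 n) x) (h : M → ℝ) (x : M) : ℝ :=
  mfderiv (𝓡 n) 𝓘(ℝ, ℝ) h x (Y x)

/-- The exterior derivative of a 1-form, evaluated on two vector fields:
`dβ(Y, Z) = Y(β(Z)) - Z(β(Y)) - β([Y, Z])`. -/
def extD (β : (x : M) → TangentSpace (𝓡 n) x →L[ℝ] ℝ)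
    (Y Z : (x : M) → TangentSpace (𝓡 n) x) (x : M) : ℝ :=
  dirDeriv Y (fun p => β p (Z p)) x - dirDeriv Z (fun p => β p (Y p)) x
    - β x (VectorField.mlieBracket (𝓡 n) Y Z x)

/-- The expression of a function `F` on `TM` in the coordinates `(u, y)` of `TM` that come from a
chart `e` of `M`: here `y` stands for the tangent vector `yⁱ ∂/∂uⁱ` at the point `e⁻¹(u)`. -/
def localExpr (F : (x : M) → TangentSpace (𝓡 n) x → ℝ)
    (e : OpenPartialHomeomorph M (EuclideanSpace ℝ (Fin n)))
    (u y : EuclideanSpace ℝ (Fin n)) : ℝ :=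
  F (e.symm u) (mfderiv (𝓡 n) (𝓡 n) e.symm u y)

variable [IsManifold (𝓡 n) ∞ M]

/-- `F` is a Finsler metric: a function on `TM`, smooth away from the zero section, positively
homogeneous of degree one and positive on nonzero vectors, whose fundamental tensor
`g_y(v, v) = (1/2) d²/dt² F(y + t v)² |_{t = 0}` is positive definite for each `y ≠ 0`. -/
structure IsFinslerMetric (F : (x : M) → TangentSpace (𝓡 n) x → ℝ) : Prop where
  smooth : ContMDiffOn (𝓡 n).tangent 𝓘(ℝ, ℝ) ∞
    (fun p : TangentBundle (𝓡 n) M => F p.1 p.2) {p : TangentBundle (𝓡 n) M | p.2 ≠ 0}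
  homogeneous : ∀ (x : M) (y : TangentSpace (𝓡 n) x) (c : ℝ), 0 ≤ c → F x (c • y) = c * F x y
  pos : ∀ (x : M) (y : TangentSpace (𝓡 n) x), y ≠ 0 → 0 < F x y
  strongly_convex : ∀ (x : M) (y v : TangentSpace (𝓡 n) x), y ≠ 0 → v ≠ 0 →
    0 < (1 / 2) * iteratedDeriv 2 (fun t : ℝ => F x (y + t • v) ^ 2) 0

/-- A Finsler metric is of Douglas type if its Douglas tensor vanishes on `TM` without the zero
section, in all coordinates of the smooth structure. -/
structure IsDouglasMetric (F : (x : M) → TangentSpace (𝓡 n) x → ℝ) : Prop where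
  isFinslerMetric : IsFinslerMetric F
  douglas_eq_zero : ∀ e ∈ IsManifold.maximalAtlas (𝓡 n) ∞ M, ∀ u ∈ e.target,
    ∀ y : EuclideanSpace ℝ (Fin n), y ≠ 0 → ∀ i j k l : Fin n,
      douglasTensor (localExpr F e) u i j k l y = 0

/-- Smoothness of a vector field, as a section of the tangent bundle. -/
def IsSmoothField (Y : (x : M) → TangentSpace (𝓡 n) x) : Prop :=
  ContMDiff (𝓡 n) (𝓡 n).tangent ∞ (fun x => (⟨x, Y x⟩ : TangentBundle (𝓡 n) M))

/-- Smoothness of a 1-form, as a section of the cotangent bundle. -/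
def IsSmoothOneForm (β : (x : M) → TangentSpace (𝓡 n) x →L[ℝ] ℝ) : Prop :=
  ContMDiff (𝓡 n) ((𝓡 n).prod 𝓘(ℝ, EuclideanSpace ℝ (Fin n) →L[ℝ] ℝ)) ∞
    (fun x => TotalSpace.mk' (EuclideanSpace ℝ (Fin n) →L[ℝ] ℝ)
      (E := fun x : M => TangentSpace (𝓡 n) x →L[ℝ] ℝ) x (β x))

variable (n M) in
/-- Smooth Riemannian metrics on `M`. -/
abbrev RiemMetric : Type _ :=
  ContMDiffRiemannianMetric (𝓡 n) ∞ (EuclideanSpace ℝ (Fin n))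
    (fun x : M => TangentSpace (𝓡 n) x)

/-- The pointwise condition `‖β‖_α < 1`: the norm of `β_x`, dual to the norm
`α(x, v) = √(g_x(v, v))` on the tangent space, is smaller than one at each point. -/
def DualNormLTOne (g : RiemMetric n M) (β : (x : M) → TangentSpace (𝓡 n) x →L[ℝ] ℝ) : Prop :=
  ∀ x : M, ∃ c : ℝ, c < 1 ∧ ∀ v : TangentSpace (𝓡 n) x, |β x v| ≤ c * Real.sqrt (g.inner x v v)

/-- `F` is the Randers metric `α + β` of the Riemannian metric `g` and the 1-form `β`. -/
structure IsRandersMetric (F : (x : M) → TangentSpace (𝓡 n) x → ℝ) (g : RiemMetric n M)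
    (β : (x : M) → TangentSpace (𝓡 n) x →L[ℝ] ℝ) : Prop where
  smooth_form : IsSmoothOneForm β
  norm_lt_one : DualNormLTOne g β
  eq_add : ∀ (x : M) (y : TangentSpace (𝓡 n) x), F x y = Real.sqrt (g.inner x y y) + β x y

end Manifold

end FinslerDouglas

end

set_option synthInstance.maxHeartbeats 400000

noncomputable section

namespace FinslerDouglas

/-! ### Linear algebra and first derivatives of a single Randers norm. -/

section RandersNorm

variable {V : Type*} [NormedAddCommGroup V] [NormedSpace ℝ V]

/-! The metric `e^f (α + β)` is again of Randers type, with Riemannian metric `e^{2f} g` and 1-form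
`e^f β`. Since `d(e^f β) = e^f (dβ + df ∧ β)` and `β = g(X, ·)`, the displayed condition says that
`e^f β` is closed. It remains to show that a Randers metric has vanishing Douglas tensor exactly
when its 1-form is closed (`douglasTensor_randersNorm_eq_zero_iff`). This is done pointwise in a
chart, using only first derivatives of the coefficients in position.

The spray has the form `G(y) = Q(y, y) + P(y) y + α(y) T y` (`exists_sprayCoeff_eq`): `Q` is the
spray of the Riemannian metric, `T` the skew endomorphism representing half the exterior derivative
of the 1-form, and `P` a scalar of degree one. The divergence of `G` is a linear form plus `(n + 1)
P`: Euler's relation handles `P`, and the terms of `α T` vanish because `a(y, T y) = 0` and `tr T =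
0`. Subtracting `(div G) y / (n + 1)` therefore removes `P` and leaves a quadratic map plus `α T`,
so the Douglas tensor is the third derivative of `α T` (`douglasTensor_randersNorm`).

If `T = 0` that tensor vanishes. Conversely, evaluated at `y` on three copies of a vector `z`
orthogonal to `y`, it is a nonzero multiple of `T z`, so `T z = 0`. In dimension one there is no
such `y`, but there every skew form is zero. -/

/-- A scalar product `a` and a linear form `b` whose norm with respect to `a` is less than one. -/
structure IsRandersPair (a : V →L[ℝ] V →L[ℝ] ℝ) (b : V →L[ℝ] ℝ) : Prop where
  symm : ∀ v w, a v w = a w v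
  pos : ∀ v, v ≠ 0 → 0 < a v v
  norm_lt_one : ∃ c : ℝ, c < 1 ∧ ∀ v, |b v| ≤ c * √(a v v)

/-- The Randers norm `√(a(y, y)) + b(y)`. -/
def randersNorm (a : V →L[ℝ] V →L[ℝ] ℝ) (b : V →L[ℝ] ℝ) (y : V) : ℝ := √(a y y) + b y

/-- The differential at `y` of the Randers norm. -/
def randersDiff (a : V →L[ℝ] V →L[ℝ] ℝ) (b : V →L[ℝ] ℝ) (y v : V) : ℝ :=
  a y v / √(a y y) + b v

/-- The fundamental form of the Randers norm at `y`. -/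
def randersForm (a : V →L[ℝ] V →L[ℝ] ℝ) (b : V →L[ℝ] ℝ) (y v w : V) : ℝ :=
  randersDiff a b y v * randersDiff a b y w
    + randersNorm a b y * (a v w / √(a y y) - a y v * a y w / √(a y y) ^ 3)

variable {a : V →L[ℝ] V →L[ℝ] ℝ} {b : V →L[ℝ] ℝ}

namespace IsRandersPair

lemma sqrt_pos (h : IsRandersPair a b) {y : V} (hy : y ≠ 0) : 0 < √(a y y) :=
  Real.sqrt_pos.2 (h.pos y hy)

lemma sq_sqrt (h : IsRandersPair a b) (y : V) : √(a y y) ^ 2 = a y y := by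
  rcases eq_or_ne y 0 with rfl | hy
  · simp
  · exact Real.sq_sqrt (h.pos y hy).le

lemma norm_pos (h : IsRandersPair a b) {y : V} (hy : y ≠ 0) : 0 < randersNorm a b y := by
  obtain ⟨c, hc, hb⟩ := h.norm_lt_one
  have h1 := h.sqrt_pos hy
  have h2 := neg_le_of_abs_le (hb y)
  unfold randersNorm
  nlinarith

/-- Split `v` into `s • y` and a part orthogonal to `y`. The second summand of the form is a
positive multiple of the squared length of the orthogonal part; when that part vanishes, the first
summand is the square of `s` times the norm of `y`. -/
lemma form_pos (h : IsRandersPair a b) {y v : V} (hy : y ≠ 0) (hv : v ≠ 0) :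
    0 < randersForm a b y v v := by
  have hα := h.sqrt_pos hy
  have hL := h.norm_pos hy
  have hsq := h.sq_sqrt y
  set s := a y v / a y y with hs
  have hyy := h.pos y hy
  have key : a v v / √(a y y) - a y v * a y v / √(a y y) ^ 3
      = a (v - s • y) (v - s • y) / √(a y y) := by
    have h3 : √(a y y) ^ 3 = a y y * √(a y y) := by rw [pow_succ, hsq]
    rw [h3]
    simp only [map_sub, map_smul, _root_.sub_apply, _root_.smul_apply,
      smul_eq_mul, hs, h.symm v y]
    field_simp
    ring
  unfold randersForm
  rw [key]
  rcases eq_or_ne (v - s • y) 0 with h0 | h0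
  · have hvs : v = s • y := sub_eq_zero.1 h0
    have hs0 : s ≠ 0 := by
      rintro h'
      exact hv (by rw [hvs, h', zero_smul])
    have : randersDiff a b y v = s * randersNorm a b y := by
      rw [hvs]
      simp only [randersDiff, randersNorm, map_smul, smul_eq_mul]
      rw [mul_add, mul_div_assoc]
      congr 2
      rw [div_eq_iff hα.ne', ← sq, hsq]
    rw [h0, this]
    simp only [map_zero, zero_div, mul_zero, add_zero]
    exact mul_self_pos.2 (mul_ne_zero hs0 hL.ne')
  · have := h.pos _ h0
    exact add_pos_of_nonneg_of_pos (mul_self_nonneg _) (mul_pos hL (div_pos this hα))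

lemma hasFDerivAt_sqrt (h : IsRandersPair a b) {y : V} (hy : y ≠ 0) :
    HasFDerivAt (fun w => √(a w w)) ((√(a y y))⁻¹ • a y) y := by
  have h1 : HasFDerivAt (fun w => a w w) (a y + a.flip y) y := by
    have := (a.hasFDerivAt (x := y)).clm_apply (hasFDerivAt_id y)
    exact this.congr_fderiv (by ext v; simp)
  refine (h1.sqrt (h.pos y hy).ne').congr_fderiv ?_
  ext v
  have := h.sqrt_pos hy
  simp [h.symm v y]
  field_simp
  ring

lemma hasFDerivAt_norm (h : IsRandersPair a b) {y : V} (hy : y ≠ 0) :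
    HasFDerivAt (randersNorm a b) ((√(a y y))⁻¹ • a y + b) y :=
  (h.hasFDerivAt_sqrt hy).add b.hasFDerivAt

lemma hasFDerivAt_diff (h : IsRandersPair a b) {y : V} (hy : y ≠ 0) (v : V) :
    HasFDerivAt (fun w => randersDiff a b w v)
      ((√(a y y))⁻¹ • a v - (a y v / √(a y y) ^ 3) • a y) y := by
  have h0 := h.sqrt_pos hy
  have h1 : HasFDerivAt (fun w => a w v) (a v) y := by
    refine (a.flip v).hasFDerivAt.congr_fderiv ?_
    ext w
    simp [h.symm v w]
  have h2 := (h1.mul ((hasFDerivAt_inv h0.ne').comp y (h.hasFDerivAt_sqrt hy))).add_const (b v)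
  refine (h2.congr_fderiv ?_).congr_of_eventuallyEq (Filter.Eventually.of_forall fun w => ?_)
  · ext w
    simp
    field_simp
    ring
  · simp [randersDiff, div_eq_mul_inv]

/-- The product differentiated here is half the differential of the squared norm, so its derivative
is the fundamental tensor. -/
lemma hasFDerivAt_norm_mul_diff (h : IsRandersPair a b) {y : V} (hy : y ≠ 0) (v : V) :
    ∃ φ : V →L[ℝ] ℝ, (∀ w, φ w = randersForm a b y w v) ∧
      HasFDerivAt (fun w => randersNorm a b w * randersDiff a b w v) φ y := by
  refine ⟨_, fun w => ?_, (h.hasFDerivAt_norm hy).mul (h.hasFDerivAt_diff hy v)⟩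
  have h0 := h.sqrt_pos hy
  simp [randersForm, randersDiff, h.symm v w]
  field_simp
  ring

lemma _root_.FinslerDouglas.randersNorm_smul {t : ℝ} (ht : 0 ≤ t) (y : V) :
    randersNorm a b (t • y) = t * randersNorm a b y := by
  have : a (t • y) (t • y) = t ^ 2 * a y y := by simp; ring
  rw [randersNorm, this, Real.sqrt_mul (sq_nonneg t), Real.sqrt_sq ht]
  simp [randersNorm]
  ring

end IsRandersPair

/-- A scalar product on a finite dimensional space identifies the space with its dual. -/
lemma exists_inverse_of_pos [FiniteDimensional ℝ V] (hpos : ∀ v, v ≠ 0 → 0 < a v v) :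
    ∃ r : (V →L[ℝ] ℝ) →L[ℝ] V, ∀ φ v, a (r φ) v = φ v := by
  let A : V →ₗ[ℝ] (V →L[ℝ] ℝ) := a
  have hinj : Function.Injective A := by
    rw [injective_iff_map_eq_zero]
    intro v hv
    by_contra hne
    have := hpos v hne
    have h' : a v = 0 := hv
    simp [h'] at this
  have hdim : Module.finrank ℝ V = Module.finrank ℝ (V →L[ℝ] ℝ) := by
    rw [← (LinearMap.toContinuousLinearMap (𝕜 := ℝ) (E := V) (F' := ℝ)).finrank_eq]
    exact (Subspace.dual_finrank_eq).symm
  let e := LinearEquiv.ofInjectiveOfFinrankEq A hinj hdim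
  refine ⟨LinearMap.toContinuousLinearMap (e.symm : (V →L[ℝ] ℝ) →ₗ[ℝ] V), fun φ v => ?_⟩
  have : A (e.symm φ) = φ := e.apply_symm_apply φ
  exact DFunLike.congr_fun this v

end RandersNorm

/-! ### Partial derivatives and Gram matrices on `ℝⁿ`. -/

section Coordinates

variable {n : ℕ}

lemma partialD_eq_of_hasFDerivAt {h : EuclideanSpace ℝ (Fin n) → ℝ}
    {u : EuclideanSpace ℝ (Fin n)} {h' : EuclideanSpace ℝ (Fin n) →L[ℝ] ℝ}
    (H : HasFDerivAt h h' u) (i : Fin n) :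
    partialD i h u = h' (EuclideanSpace.single i 1) := by
  rw [partialD, H.fderiv]

lemma partialD_eventuallyEq {h₁ h₂ : EuclideanSpace ℝ (Fin n) → ℝ}
    {u : EuclideanSpace ℝ (Fin n)} (H : h₁ =ᶠ[nhds u] h₂) (i : Fin n) :
    partialD i h₁ =ᶠ[nhds u] partialD i h₂ := by
  filter_upwards [H.fderiv (𝕜 := ℝ)] with x hx
  rw [partialD, partialD, hx]

lemma sum_smul_single (v : EuclideanSpace ℝ (Fin n)) :
    ∑ i, v i • EuclideanSpace.single i (1 : ℝ) = v := by
  ext j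
  simp [Finset.sum_apply, Pi.single_apply]

lemma sum_coord_mul_apply_single (φ : EuclideanSpace ℝ (Fin n) →L[ℝ] ℝ)
    (v : EuclideanSpace ℝ (Fin n)) :
    ∑ i, v i * φ (EuclideanSpace.single i 1) = φ v := by
  conv_rhs => rw [← sum_smul_single v, map_sum]
  simp

lemma eq_zero_of_apply_single {φ : EuclideanSpace ℝ (Fin n) →L[ℝ] ℝ}
    (h : ∀ i, φ (EuclideanSpace.single i 1) = 0) : φ = 0 := by
  ext v
  rw [← sum_coord_mul_apply_single φ v]
  simp [h]

/-- A kernel vector `v` of the Gram matrix would satisfy `B v v = 0`. Symmetry of `B` plays no role.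
-/
lemma isUnit_det_of_pos (B : EuclideanSpace ℝ (Fin n) →L[ℝ] EuclideanSpace ℝ (Fin n) →L[ℝ] ℝ)
    (hB : ∀ v, v ≠ 0 → 0 < B v v) :
    IsUnit (Matrix.of fun i j : Fin n =>
      B (EuclideanSpace.single i 1) (EuclideanSpace.single j 1)).det := by
  rw [isUnit_iff_ne_zero]
  intro h0
  obtain ⟨v, hv, hMv⟩ := Matrix.exists_mulVec_eq_zero_iff.2 h0
  have hv' : WithLp.toLp 2 v ≠ 0 := by simpa using hv
  have h1 := hB _ hv'
  have h2 : ∀ i : Fin n, B (EuclideanSpace.single i 1) (WithLp.toLp 2 v) = 0 := by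
    intro i
    have := congrFun hMv i
    rw [← sum_coord_mul_apply_single]
    simpa [Matrix.mulVec, dotProduct, mul_comm] using this
  have h3 : B.flip (WithLp.toLp 2 v) = 0 := eq_zero_of_apply_single fun i => by simpa using h2 i
  have h4 := DFunLike.congr_fun h3 (WithLp.toLp 2 v)
  simp only [ContinuousLinearMap.flip_apply, _root_.zero_apply] at h4
  exact h1.ne' h4

end Coordinates

/-! ### The spray equations of a Randers metric. -/

section Spray

/-- The fundamental form of a Randers norm is bilinear. -/
lemma exists_bilin_eq_randersForm {V : Type*} [NormedAddCommGroup V] [NormedSpace ℝ V]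
    (a : V →L[ℝ] V →L[ℝ] ℝ) (b : V →L[ℝ] ℝ) (y : V) :
    ∃ B : V →L[ℝ] V →L[ℝ] ℝ, ∀ v w, B v w = randersForm a b y v w := by
  let φ : V →L[ℝ] ℝ := (√(a y y))⁻¹ • a y + b
  refine ⟨φ.smulRight φ + (randersNorm a b y / √(a y y)) • a
    - (randersNorm a b y / √(a y y) ^ 3) • (a y).smulRight (a y), fun v w => ?_⟩
  simp [φ, randersForm, randersDiff]
  ring

variable {n : ℕ}

lemma partialD_sq_randersNorm
    {A : EuclideanSpace ℝ (Fin n) →L[ℝ] EuclideanSpace ℝ (Fin n) →L[ℝ] ℝ}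
    {B : EuclideanSpace ℝ (Fin n) →L[ℝ] ℝ} (h : IsRandersPair A B)
    {y : EuclideanSpace ℝ (Fin n)} (hy : y ≠ 0) (l : Fin n) :
    partialD l (fun w => randersNorm A B w ^ 2) y
      = 2 * (randersNorm A B y * randersDiff A B y (EuclideanSpace.single l 1)) := by
  rw [partialD_eq_of_hasFDerivAt ((h.hasFDerivAt_norm hy).pow 2)]
  simp [randersDiff]
  ring

variable {a : EuclideanSpace ℝ (Fin n) →
    EuclideanSpace ℝ (Fin n) →L[ℝ] EuclideanSpace ℝ (Fin n) →L[ℝ] ℝ}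
  {b : EuclideanSpace ℝ (Fin n) → EuclideanSpace ℝ (Fin n) →L[ℝ] ℝ}
  {a' : EuclideanSpace ℝ (Fin n) →L[ℝ]
    EuclideanSpace ℝ (Fin n) →L[ℝ] EuclideanSpace ℝ (Fin n) →L[ℝ] ℝ}
  {b' : EuclideanSpace ℝ (Fin n) →L[ℝ] EuclideanSpace ℝ (Fin n) →L[ℝ] ℝ}
  {u y : EuclideanSpace ℝ (Fin n)}

lemma fundamentalMatrix_randersNorm (h : IsRandersPair (a u) (b u)) (hy : y ≠ 0) :
    fundamentalMatrix (fun x w => randersNorm (a x) (b x) w) u y = Matrix.of fun i j =>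
      randersForm (a u) (b u) y (EuclideanSpace.single i 1) (EuclideanSpace.single j 1) := by
  ext i j
  obtain ⟨φ, hφ, hd⟩ := h.hasFDerivAt_norm_mul_diff hy (EuclideanSpace.single j 1)
  have : partialD j (fun w => randersNorm (a u) (b u) w ^ 2) =ᶠ[nhds y] fun w =>
      2 * (randersNorm (a u) (b u) w * randersDiff (a u) (b u) w (EuclideanSpace.single j 1)) := by
    filter_upwards [isOpen_ne.mem_nhds hy] with w hw
    exact partialD_sq_randersNorm h hw j
  rw [fundamentalMatrix, Matrix.of_apply, Matrix.of_apply, (partialD_eventuallyEq this i).eq_of_nhds,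
    partialD_eq_of_hasFDerivAt (hd.const_mul 2)]
  simp [hφ]

lemma hasFDerivAt_sqrt_base (h : IsRandersPair (a u) (b u)) (ha : HasFDerivAt a a' u)
    (hy : y ≠ 0) :
    HasFDerivAt (fun x => √(a x y y)) ((2 * √(a u y y))⁻¹ • (a'.flip y).flip y) u := by
  have h1 : HasFDerivAt (fun x => a x y y) ((a'.flip y).flip y) u :=
    ((ha.clm_apply (hasFDerivAt_const y u)).clm_apply (hasFDerivAt_const y u)).congr_fderiv
      (by ext v; simp)
  refine (h1.sqrt (h.pos y hy).ne').congr_fderiv ?_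
  ext v
  simp

lemma hasFDerivAt_randersNorm_base (h : IsRandersPair (a u) (b u)) (ha : HasFDerivAt a a' u)
    (hb : HasFDerivAt b b' u) (hy : y ≠ 0) :
    HasFDerivAt (fun x => randersNorm (a x) (b x) y)
      ((2 * √(a u y y))⁻¹ • (a'.flip y).flip y + b'.flip y) u := by
  have h1 : HasFDerivAt (fun x => b x y) (b'.flip y) u :=
    (hb.clm_apply (hasFDerivAt_const y u)).congr_fderiv (by ext v; simp)
  exact (hasFDerivAt_sqrt_base h ha hy).add h1

lemma hasFDerivAt_randersDiff_base (h : IsRandersPair (a u) (b u)) (ha : HasFDerivAt a a' u)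
    (hb : HasFDerivAt b b' u) (hy : y ≠ 0) (v : EuclideanSpace ℝ (Fin n)) :
    HasFDerivAt (fun x => randersDiff (a x) (b x) y v)
      ((√(a u y y))⁻¹ • (a'.flip y).flip v
        - (a u y v / (2 * √(a u y y) ^ 3)) • (a'.flip y).flip y + b'.flip v) u := by
  have h0 := h.sqrt_pos hy
  have h1 : HasFDerivAt (fun x => b x v) (b'.flip v) u :=
    (hb.clm_apply (hasFDerivAt_const v u)).congr_fderiv (by ext v; simp)
  have h2 : HasFDerivAt (fun x => a x y v) ((a'.flip y).flip v) u :=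
    ((ha.clm_apply (hasFDerivAt_const y u)).clm_apply (hasFDerivAt_const v u)).congr_fderiv
      (by ext v; simp)
  have h3 := (h2.mul ((hasFDerivAt_inv h0.ne').comp u (hasFDerivAt_sqrt_base h ha hy))).add h1
  refine (h3.congr_fderiv ?_).congr_of_eventuallyEq (Filter.Eventually.of_forall fun w => ?_)
  · ext w
    simp
    field_simp
    ring
  · simp [randersDiff, div_eq_mul_inv]

/-- The Euler-Lagrange expression `yᵏ ∂²(L²)/∂uᵏ∂yˡ - ∂(L²)/∂uˡ` of a Randers metric. -/
lemma euler_lagrange_randersNorm (h : ∀ᶠ x in nhds u, IsRandersPair (a x) (b x))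
    (ha : HasFDerivAt a a' u) (hb : HasFDerivAt b b' u) (hy : y ≠ 0) (l : Fin n)
    {v : EuclideanSpace ℝ (Fin n)} (hv : v = EuclideanSpace.single l 1) :
    (∑ k : Fin n, y k * partialD k
        (fun x => partialD l (fun w => randersNorm (a x) (b x) w ^ 2) y) u)
      - partialD l (fun x => randersNorm (a x) (b x) y ^ 2) u
    = 2 * ((a' y y y / (2 * √(a u y y)) + b' y y) * randersDiff (a u) (b u) y v
      + randersNorm (a u) (b u) y * (a' y y v / √(a u y y)
        - a u y v * a' y y y / (2 * √(a u y y) ^ 3) + b' y v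
        - a' v y y / (2 * √(a u y y)) - b' v y)) := by
  subst hv
  have hu := h.self_of_nhds
  have h1 : (fun x => partialD l (fun w => randersNorm (a x) (b x) w ^ 2) y) =ᶠ[nhds u] fun x =>
      2 * (randersNorm (a x) (b x) y
        * randersDiff (a x) (b x) y (EuclideanSpace.single l 1)) := by
    filter_upwards [h] with x hx
    exact partialD_sq_randersNorm hx hy l
  have h2 := ((hasFDerivAt_randersNorm_base hu ha hb hy).mul
    (hasFDerivAt_randersDiff_base hu ha hb hy (EuclideanSpace.single l 1))).const_mul 2
  have h3 := (hasFDerivAt_randersNorm_base hu ha hb hy).pow 2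
  rw [partialD_eq_of_hasFDerivAt h3]
  have h4 := fun k => ((partialD_eventuallyEq h1 k).eq_of_nhds).trans
    (partialD_eq_of_hasFDerivAt h2 k)
  simp_rw [h4]
  rw [sum_coord_mul_apply_single]
  have h0 := hu.sqrt_pos hy
  simp
  field_simp
  ring

/-- A vector that solves the spray equations of a Randers metric gives its spray coefficients. -/
lemma sprayCoeff_eq_of_forall (h : ∀ᶠ x in nhds u, IsRandersPair (a x) (b x))
    (ha : HasFDerivAt a a' u) (hb : HasFDerivAt b b' u) (hy : y ≠ 0)
    {G : EuclideanSpace ℝ (Fin n)}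
    (hG : ∀ v, 4 * randersForm (a u) (b u) y v G
      = 2 * ((a' y y y / (2 * √(a u y y)) + b' y y) * randersDiff (a u) (b u) y v
      + randersNorm (a u) (b u) y * (a' y y v / √(a u y y)
        - a u y v * a' y y y / (2 * √(a u y y) ^ 3) + b' y v
        - a' v y y / (2 * √(a u y y)) - b' v y))) (i : Fin n) :
    sprayCoeff (fun x w => randersNorm (a x) (b x) w) u i y = G i := by
  have hu := h.self_of_nhds
  obtain ⟨B, hB⟩ := exists_bilin_eq_randersForm (a u) (b u) y
  have hdet := isUnit_det_of_pos B fun v hv => by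
    rw [hB]
    exact hu.form_pos hy hv
  have hM : fundamentalMatrix (fun x w => randersNorm (a x) (b x) w) u y = Matrix.of fun i j =>
      B (EuclideanSpace.single i 1) (EuclideanSpace.single j 1) := by
    simp_rw [hB, fundamentalMatrix_randersNorm hu hy]
  set N := Matrix.of fun i j : Fin n =>
      B (EuclideanSpace.single i 1) (EuclideanSpace.single j 1) with hN
  -- The hypothesis on `G`, tested on basis vectors, is the linear system `4 N G = E` with `E` the
  -- Euler-Lagrange covector; the factor `1/4` of `sprayCoeff` cancels the `4`.
  have hR : ∀ l : Fin n, (∑ k : Fin n, y k * partialD k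
        (fun x => partialD l (fun w => randersNorm (a x) (b x) w ^ 2) y) u)
      - partialD l (fun x => randersNorm (a x) (b x) y ^ 2) u = 4 * (N.mulVec G.ofLp) l := by
    intro l
    rw [euler_lagrange_randersNorm h ha hb hy l rfl, ← hG, ← hB, ← sum_coord_mul_apply_single]
    simp [Matrix.mulVec, dotProduct, hN, mul_comm]
  rw [sprayCoeff, hM]
  simp_rw [hR]
  have : (N⁻¹.mulVec (N.mulVec G.ofLp)) i = G i := by
    rw [Matrix.mulVec_mulVec, Matrix.nonsing_inv_mul N hdet, Matrix.one_mulVec]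
  rw [← this, Matrix.mulVec, dotProduct, Finset.mul_sum]
  refine Finset.sum_congr rfl fun l _ => ?_
  ring

end Spray

/-! ### Three derivatives of `√a · τ`, and Euler's relation. -/

section ThirdDerivative

variable {V : Type*} [NormedAddCommGroup V] [NormedSpace ℝ V]

/-- The third derivative at `y` of `w ↦ √(a(w, w)) τ(w)`, where `a` is a scalar product and `τ` a
linear form. -/
def thirdDiffSqrtMul (a : V →L[ℝ] V →L[ℝ] ℝ) (τ : V →L[ℝ] ℝ) (y v₁ v₂ v₃ : V) : ℝ :=
  (-(a v₂ v₃ * a y v₁ + a v₁ v₃ * a y v₂ + a v₁ v₂ * a y v₃) / √(a y y) ^ 3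
      + 3 * a y v₁ * a y v₂ * a y v₃ / √(a y y) ^ 5) * τ y
    + (a v₂ v₃ / √(a y y) - a y v₂ * a y v₃ / √(a y y) ^ 3) * τ v₁
    + (a v₁ v₃ / √(a y y) - a y v₁ * a y v₃ / √(a y y) ^ 3) * τ v₂
    + (a v₁ v₂ / √(a y y) - a y v₁ * a y v₂ / √(a y y) ^ 3) * τ v₃

variable {a : V →L[ℝ] V →L[ℝ] ℝ} {b τ : V →L[ℝ] ℝ} {y : V}

lemma thirdDiffSqrtMul_swap_left (h : IsRandersPair a b) (v₁ v₂ v₃ : V) :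
    thirdDiffSqrtMul a τ y v₁ v₂ v₃ = thirdDiffSqrtMul a τ y v₂ v₁ v₃ := by
  rw [thirdDiffSqrtMul, thirdDiffSqrtMul, h.symm v₁ v₂]
  ring

lemma thirdDiffSqrtMul_swap_right (h : IsRandersPair a b) (v₁ v₂ v₃ : V) :
    thirdDiffSqrtMul a τ y v₁ v₂ v₃ = thirdDiffSqrtMul a τ y v₁ v₃ v₂ := by
  rw [thirdDiffSqrtMul, thirdDiffSqrtMul, h.symm v₂ v₃]
  ring

/-- Linearity in the first slot; with the two swap lemmas it gives linearity in every slot, so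
vanishing can be tested on basis vectors. -/
lemma exists_eq_thirdDiffSqrtMul (h : IsRandersPair a b) (v₂ v₃ : V) :
    ∃ φ : V →L[ℝ] ℝ, ∀ v, φ v = thirdDiffSqrtMul a τ y v v₂ v₃ := by
  set α := √(a y y) with hα
  refine ⟨τ y • ((-(a v₂ v₃) / α ^ 3 + 3 * a y v₂ * a y v₃ / α ^ 5) • a y
      - (a y v₂ / α ^ 3) • a v₃ - (a y v₃ / α ^ 3) • a v₂)
    + (a v₂ v₃ / α - a y v₂ * a y v₃ / α ^ 3) • τ
    + τ v₂ • (α⁻¹ • a v₃ - (a y v₃ / α ^ 3) • a y)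
    + τ v₃ • (α⁻¹ • a v₂ - (a y v₂ / α ^ 3) • a y), fun v => ?_⟩
  simp only [thirdDiffSqrtMul, ← hα, h.symm v, _root_.add_apply, _root_.sub_apply,
    _root_.smul_apply, smul_eq_mul]
  ring

/-- On a vector orthogonal to `y` the third derivative of `√a · τ` is a multiple of `τ`. -/
lemma thirdDiffSqrtMul_of_orthogonal {z : V} (hz : a y z = 0) :
    thirdDiffSqrtMul a τ y z z z = 3 * (a z z / √(a y y)) * τ z := by
  rw [thirdDiffSqrtMul, hz]
  ring

lemma hasFDerivAt_bilin_self (B : V →L[ℝ] V →L[ℝ] ℝ) (y : V) :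
    HasFDerivAt (fun w => B w w) (B y + B.flip y) y := by
  have := (B.hasFDerivAt (x := y)).clm_apply (hasFDerivAt_id y)
  exact this.congr_fderiv (by ext v; simp)

namespace IsRandersPair

lemma hasFDerivAt_div_sqrt (h : IsRandersPair a b) (hy : y ≠ 0) (v : V) :
    HasFDerivAt (fun w => a w v / √(a w w))
      ((√(a y y))⁻¹ • a v - (a y v / √(a y y) ^ 3) • a y) y := by
  refine ((h.hasFDerivAt_diff hy v).sub_const (b v)).congr_of_eventuallyEq
    (Filter.Eventually.of_forall fun w => ?_)
  simp [randersDiff]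

/-- This and the next two lemmas differentiate `B(w, w) + √a τ` once, twice and three times; the
quadratic part `B` has disappeared after the third. -/
lemma exists_hasFDerivAt_sqrt_mul (h : IsRandersPair a b) (hy : y ≠ 0)
    (B : V →L[ℝ] V →L[ℝ] ℝ) (τ : V →L[ℝ] ℝ) :
    ∃ φ : V →L[ℝ] ℝ, (∀ v, φ v = B y v + B v y + a y v / √(a y y) * τ y + √(a y y) * τ v) ∧
      HasFDerivAt (fun w => B w w + √(a w w) * τ w) φ y := by
  refine ⟨_, fun v => ?_, (hasFDerivAt_bilin_self B y).add
    ((h.hasFDerivAt_sqrt hy).mul τ.hasFDerivAt)⟩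
  simp
  ring

lemma exists_hasFDerivAt_fderiv_sqrt_mul (h : IsRandersPair a b) (hy : y ≠ 0)
    (B : V →L[ℝ] V →L[ℝ] ℝ) (τ : V →L[ℝ] ℝ) (v₃ : V) :
    ∃ φ : V →L[ℝ] ℝ, (∀ v, φ v = B v v₃ + B v₃ v
        + (a v v₃ / √(a y y) - a y v * a y v₃ / √(a y y) ^ 3) * τ y
        + a y v₃ / √(a y y) * τ v + a y v / √(a y y) * τ v₃) ∧
      HasFDerivAt (fun w => B w v₃ + B v₃ w + a w v₃ / √(a w w) * τ w + √(a w w) * τ v₃)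
        φ y := by
  refine ⟨_, fun v => ?_, (((B.flip v₃).hasFDerivAt.add (B v₃).hasFDerivAt).add
    ((h.hasFDerivAt_div_sqrt hy v₃).mul τ.hasFDerivAt)).add
      ((h.hasFDerivAt_sqrt hy).mul_const (τ v₃))⟩
  simp [h.symm v v₃]
  ring

lemma exists_hasFDerivAt_fderiv_fderiv_sqrt_mul (h : IsRandersPair a b) (hy : y ≠ 0)
    (B : V →L[ℝ] V →L[ℝ] ℝ) (τ : V →L[ℝ] ℝ) (v₂ v₃ : V) :
    ∃ φ : V →L[ℝ] ℝ, (∀ v, φ v = thirdDiffSqrtMul a τ y v v₂ v₃) ∧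
      HasFDerivAt (fun w => B v₂ v₃ + B v₃ v₂
        + (a v₂ v₃ / √(a w w) - a w v₂ * a w v₃ / √(a w w) ^ 3) * τ w
        + a w v₃ / √(a w w) * τ v₂ + a w v₂ / √(a w w) * τ v₃) φ y := by
  have h0 := h.sqrt_pos hy
  have hp := h.hasFDerivAt_div_sqrt hy
  have hinv := (hasFDerivAt_inv h0.ne').comp y (h.hasFDerivAt_sqrt hy)
  refine ⟨_, fun v => ?_, HasFDerivAt.congr_of_eventuallyEq
    ((((((hinv.const_mul (a v₂ v₃)).sub (((hp v₂).mul (hp v₃)).mul hinv)).mul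
      τ.hasFDerivAt).const_add (B v₂ v₃ + B v₃ v₂)).add ((hp v₃).mul_const (τ v₂))).add
        ((hp v₂).mul_const (τ v₃))) ?_⟩
  · simp [thirdDiffSqrtMul, h.symm v]
    field_simp
    ring
  · filter_upwards [isOpen_ne.mem_nhds hy] with w hw
    have := h.sqrt_pos hw
    simp
    left
    field_simp

end IsRandersPair

/-- Euler's relation for functions that are positively homogeneous of degree one. -/
lemma hasFDerivAt_apply_self_of_homogeneous {f : V → ℝ} {f' : V →L[ℝ] ℝ}
    (hf : HasFDerivAt f f' y) (hom : ∀ t : ℝ, 0 < t → f (t • y) = t * f y) : f' y = f y := by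
  have h1 : HasDerivAt (fun t : ℝ => t • y) y 1 := by
    simpa using (hasDerivAt_id (1 : ℝ)).smul_const y
  have h2 : HasDerivAt (fun t : ℝ => f (t • y)) (f' y) 1 :=
    HasFDerivAt.comp_hasDerivAt 1 (by simpa using hf) h1
  have h3 : HasDerivAt (fun t : ℝ => f (t • y)) (f y) 1 := by
    have : HasDerivAt (fun t : ℝ => t * f y) (f y) 1 := by
      simpa using (hasDerivAt_id (1 : ℝ)).mul_const (f y)
    refine this.congr_of_eventuallyEq ?_
    filter_upwards [lt_mem_nhds (zero_lt_one (α := ℝ))] with t ht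
    exact hom t ht
  exact h2.unique h3

end ThirdDerivative

/-! ### From third partial derivatives to the linear form `τ`, and traces of skew maps. -/

section Douglas

variable {n : ℕ}

/-- Third partial derivatives of a sum of a quadratic form and `√a · τ`. -/
lemma partialD_three_sqrt_mul
    {a : EuclideanSpace ℝ (Fin n) →L[ℝ] EuclideanSpace ℝ (Fin n) →L[ℝ] ℝ}
    {b : EuclideanSpace ℝ (Fin n) →L[ℝ] ℝ} (h : IsRandersPair a b)
    (B : EuclideanSpace ℝ (Fin n) →L[ℝ] EuclideanSpace ℝ (Fin n) →L[ℝ] ℝ)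
    (τ : EuclideanSpace ℝ (Fin n) →L[ℝ] ℝ) {f : EuclideanSpace ℝ (Fin n) → ℝ}
    (hf : ∀ w, w ≠ 0 → f w = B w w + √(a w w) * τ w) {y : EuclideanSpace ℝ (Fin n)} (hy : y ≠ 0)
    (j k l : Fin n) :
    partialD j (partialD k (partialD l f)) y = thirdDiffSqrtMul a τ y
      (EuclideanSpace.single j 1) (EuclideanSpace.single k 1) (EuclideanSpace.single l 1) := by
  have hne : ∀ {w : EuclideanSpace ℝ (Fin n)}, w ≠ 0 → ∀ᶠ x in nhds w, x ≠ 0 :=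
    fun hw => isOpen_ne.mem_nhds hw
  have h1 : ∀ w, w ≠ 0 → partialD l f w = _ := fun w hw => by
    obtain ⟨φ, hφ, hd⟩ := h.exists_hasFDerivAt_sqrt_mul hw B τ
    rw [partialD_eq_of_hasFDerivAt (hd.congr_of_eventuallyEq ((hne hw).mono hf)), hφ]
  have h2 : ∀ w, w ≠ 0 → partialD k (partialD l f) w = _ := fun w hw => by
    obtain ⟨φ, hφ, hd⟩ := h.exists_hasFDerivAt_fderiv_sqrt_mul hw B τ (EuclideanSpace.single l 1)
    rw [partialD_eq_of_hasFDerivAt (hd.congr_of_eventuallyEq ((hne hw).mono h1)), hφ]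
  obtain ⟨φ, hφ, hd⟩ := h.exists_hasFDerivAt_fderiv_fderiv_sqrt_mul hy B τ
    (EuclideanSpace.single k 1) (EuclideanSpace.single l 1)
  rw [partialD_eq_of_hasFDerivAt (hd.congr_of_eventuallyEq ((hne hy).mono h2)), hφ]

/-- If the third derivative of `√a · τ` vanishes away from the origin, then `τ` vanishes on each
vector with a nontrivial orthogonal complement. -/
lemma eq_zero_of_thirdDiffSqrtMul
    {a : EuclideanSpace ℝ (Fin n) →L[ℝ] EuclideanSpace ℝ (Fin n) →L[ℝ] ℝ}
    {b τ : EuclideanSpace ℝ (Fin n) →L[ℝ] ℝ} (h : IsRandersPair a b)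
    {y z : EuclideanSpace ℝ (Fin n)} (hy : y ≠ 0) (hz : z ≠ 0) (hyz : a y z = 0)
    (h0 : ∀ j k l : Fin n, thirdDiffSqrtMul a τ y
      (EuclideanSpace.single j 1) (EuclideanSpace.single k 1) (EuclideanSpace.single l 1) = 0) :
    τ z = 0 := by
  have ext : ∀ v₂ v₃ : EuclideanSpace ℝ (Fin n),
      (∀ j, thirdDiffSqrtMul a τ y (EuclideanSpace.single j 1) v₂ v₃ = 0) →
      ∀ v, thirdDiffSqrtMul a τ y v v₂ v₃ = 0 := by
    intro v₂ v₃ hj v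
    obtain ⟨φ, hφ⟩ := exists_eq_thirdDiffSqrtMul (τ := τ) (y := y) h v₂ v₃
    rw [← hφ, eq_zero_of_apply_single (φ := φ) fun i => by rw [hφ, hj]]
    rfl
  have h1 : ∀ v (k l : Fin n), thirdDiffSqrtMul a τ y v
      (EuclideanSpace.single k 1) (EuclideanSpace.single l 1) = 0 :=
    fun v k l => ext _ _ (fun j => h0 j k l) v
  have h2 : ∀ v v' (l : Fin n), thirdDiffSqrtMul a τ y v v' (EuclideanSpace.single l 1) = 0 :=
    fun v v' l => ext _ _ (fun j => by rw [thirdDiffSqrtMul_swap_left h]; exact h1 _ _ _) v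
  have h3 : thirdDiffSqrtMul a τ y z z z = 0 :=
    ext _ _ (fun j => by
      rw [thirdDiffSqrtMul_swap_left h, thirdDiffSqrtMul_swap_right h]; exact h2 _ _ _) z
  rw [thirdDiffSqrtMul_of_orthogonal hyz] at h3
  have := h.pos z hz
  have := h.sqrt_pos hy
  have h4 : 3 * (a z z / √(a y y)) ≠ 0 := by positivity
  exact (mul_eq_zero.1 h3).resolve_left h4

/-- An endomorphism that is skew with respect to a scalar product has trace zero. -/
lemma sum_apply_single_eq_zero_of_skew
    {a : EuclideanSpace ℝ (Fin n) →L[ℝ] EuclideanSpace ℝ (Fin n) →L[ℝ] ℝ}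
    (hsymm : ∀ v w, a v w = a w v) (hpos : ∀ v, v ≠ 0 → 0 < a v v)
    {T : EuclideanSpace ℝ (Fin n) →L[ℝ] EuclideanSpace ℝ (Fin n)}
    (hT : ∀ v w, a (T v) w = - a (T w) v) :
    ∑ m : Fin n, T (EuclideanSpace.single m 1) m = 0 := by
  have hdet := isUnit_det_of_pos a hpos
  set A := Matrix.of fun i j : Fin n =>
    a (EuclideanSpace.single i 1) (EuclideanSpace.single j 1) with hA
  set N : Matrix (Fin n) (Fin n) ℝ := Matrix.of fun i j => T (EuclideanSpace.single j 1) i with hN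
  have hAN : ∀ i j, (A * N) i j = a (T (EuclideanSpace.single j 1)) (EuclideanSpace.single i 1) := by
    intro i j
    rw [hsymm, ← sum_coord_mul_apply_single]
    simp [Matrix.mul_apply, hA, hN, mul_comm]
  have hAt : A.transpose = A := by
    ext i j
    simp [hA, hsymm (EuclideanSpace.single i 1)]
  have h1 : A * N = -(N.transpose * A) := by
    ext i j
    have : N.transpose * A = (A * N).transpose := by rw [Matrix.transpose_mul, hAt]
    rw [this, Matrix.neg_apply, Matrix.transpose_apply, hAN, hAN, hT]
  -- `N = A⁻¹ (A N) = -A⁻¹ Nᵀ A`, so `N` is conjugate to `-Nᵀ`.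
  have h2 : N.trace = - N.trace := by
    conv_lhs => rw [← Matrix.one_mul N, ← Matrix.nonsing_inv_mul A hdet, Matrix.mul_assoc, h1,
      Matrix.mul_neg, Matrix.trace_neg, Matrix.trace_mul_comm, Matrix.mul_assoc,
      Matrix.mul_nonsing_inv A hdet, Matrix.mul_one, Matrix.trace_transpose]
  have h3 : N.trace = 0 := by linarith
  simpa [Matrix.trace, hN] using h3

end Douglas

/-! ### Decomposition of the Randers spray and its Douglas tensor. -/

section DouglasRanders

/-- The quadratic and the linear part of the spray of a Randers metric. -/
lemma exists_spray_parts {V : Type*} [NormedAddCommGroup V] [NormedSpace ℝ V]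
    [FiniteDimensional ℝ V] {a : V →L[ℝ] V →L[ℝ] ℝ} (hpos : ∀ v, v ≠ 0 → 0 < a v v)
    (a' : V →L[ℝ] V →L[ℝ] V →L[ℝ] ℝ) (b' : V →L[ℝ] V →L[ℝ] ℝ) :
    ∃ (Q : V →L[ℝ] V →L[ℝ] V) (T : V →L[ℝ] V),
      (∀ w v, a (Q w w) v = (1 / 2) * a' w w v - (1 / 4) * a' v w w) ∧
      ∀ w v, a (T w) v = (1 / 2) * (b' w v - b' v w) := by
  obtain ⟨r, hr⟩ := exists_inverse_of_pos hpos
  let flipL : (V →L[ℝ] V →L[ℝ] ℝ) →L[ℝ] (V →L[ℝ] V →L[ℝ] ℝ) :=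
    (ContinuousLinearMap.flipₗᵢ ℝ V V ℝ : (V →L[ℝ] V →L[ℝ] ℝ) ≃ₗᵢ[ℝ] _).toContinuousLinearEquiv
  let R := ContinuousLinearMap.compL ℝ V (V →L[ℝ] ℝ) V r
  -- The two flips move the differentiation slot of `a'` to the end, making `a' v w w` a functional
  -- of `v` that `r` can represent. Only the diagonal of `Q` matters, so it is not symmetrized.
  refine ⟨(1 / 2 : ℝ) • R ∘L a' - (1 / 4 : ℝ) • R ∘L flipL ∘L a'.flip,
    r ∘L ((1 / 2 : ℝ) • (b' - b'.flip)), fun w v => ?_, fun w v => ?_⟩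
  · have : ∀ A : V →L[ℝ] V →L[ℝ] ℝ, flipL A = A.flip := fun A => rfl
    simp [hr, R, this]
  · simp [hr]

lemma diff_identity {α : ℝ} (hα : α ≠ 0) (q P t β γ δ : ℝ) :
    (q + P * α ^ 2 + α * t) / α + (γ + P * β + α * δ)
      = q / α + γ + P * (α + β) + α * (t / α + δ) := by
  field_simp
  ring

lemma form_identity {α : ℝ} (hα : α ≠ 0) (A B L P k m p r s β : ℝ) :
    4 * ((p / α + β) * ((A / (2 * α) + B) / 2)
      + L * ((1 / 2 * m - 1 / 4 * k + P * p + α * (1 / 2 * (s - r))) / α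
        - p * (1 / 4 * A + P * α ^ 2) / α ^ 3))
    = 2 * ((A / (2 * α) + B) * (p / α + β)
      + L * (m / α - p * A / (2 * α ^ 3) + s - k / (2 * α) - r)) := by
  field_simp
  ring

/-- The factor `P(y)` in the decomposition `Q(y, y) + P(y) y + √(a(y, y)) T y` of the spray of a
Randers metric `√a + b`. -/
def sprayFactor {V : Type*} [NormedAddCommGroup V] [NormedSpace ℝ V]
    (a : V →L[ℝ] V →L[ℝ] ℝ) (b : V →L[ℝ] ℝ) (a' : V →L[ℝ] V →L[ℝ] V →L[ℝ] ℝ)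
    (b' : V →L[ℝ] V →L[ℝ] ℝ) (Q : V →L[ℝ] V →L[ℝ] V) (T : V →L[ℝ] V) (y : V) : ℝ :=
  (a' y y y / (2 * √(a y y)) + b' y y - 2 * (a y (Q y y) / √(a y y) + b (Q y y))
    - 2 * √(a y y) * (a y (T y) / √(a y y) + b (T y))) / (2 * (√(a y y) + b y))

section SprayFactor

variable {V : Type*} [NormedAddCommGroup V] [NormedSpace ℝ V]
  {a : V →L[ℝ] V →L[ℝ] ℝ} {b : V →L[ℝ] ℝ} {a' : V →L[ℝ] V →L[ℝ] V →L[ℝ] ℝ}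
  {b' : V →L[ℝ] V →L[ℝ] ℝ} {Q : V →L[ℝ] V →L[ℝ] V} {T : V →L[ℝ] V} {y : V}

/-- The numerator has degree two and the denominator degree one. This feeds Euler's relation for
`P`. -/
lemma sprayFactor_smul {t : ℝ} (ht : 0 < t) :
    sprayFactor a b a' b' Q T (t • y) = t * sprayFactor a b a' b' Q T y := by
  have hst : √(a (t • y) (t • y)) = t * √(a y y) := by
    have : a (t • y) (t • y) = t ^ 2 * a y y := by simp; ring
    rw [this, Real.sqrt_mul (sq_nonneg t), Real.sqrt_sq ht.le]
  have ht0 := ht.ne'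
  have h2 : t * √(a y y) + b (t • y) = t * (√(a y y) + b y) := by
    simp; ring
  simp only [sprayFactor, hst, h2]
  simp only [map_smul, _root_.smul_apply, smul_eq_mul]
  field_simp

lemma IsRandersPair.differentiableAt_sprayFactor (h : IsRandersPair a b) (hy : y ≠ 0) :
    DifferentiableAt ℝ (sprayFactor a b a' b' Q T) y := by
  have h0 := h.sqrt_pos hy
  have h1 : √(a y y) + b y ≠ 0 := (h.norm_pos hy).ne'
  have hs : DifferentiableAt ℝ (fun w => √(a w w)) y := (h.hasFDerivAt_sqrt hy).differentiableAt
  have hdiv : ∀ p q : V → ℝ, DifferentiableAt ℝ p y → DifferentiableAt ℝ q y → q y ≠ 0 →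
      DifferentiableAt ℝ (fun w => p w / q w) y := fun p q hp hq hne => by
    simp only [div_eq_mul_inv]
    exact hp.fun_mul (hq.inv hne)
  have h2 : DifferentiableAt ℝ (fun y => a' y y y) y := by fun_prop
  have h3 : DifferentiableAt ℝ (fun y => b' y y) y := by fun_prop
  have h4 : DifferentiableAt ℝ (fun y => a y (Q y y)) y := by fun_prop
  have h5 : DifferentiableAt ℝ (fun y => b (Q y y)) y := by fun_prop
  have h6 : DifferentiableAt ℝ (fun y => a y (T y)) y := by fun_prop
  have h7 : DifferentiableAt ℝ (fun y => b (T y)) y := by fun_prop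
  have h8 : DifferentiableAt ℝ (fun y => b y) y := by fun_prop
  have k2 := hdiv _ _ h2 (hs.const_mul 2) (by simpa using h0.ne')
  have k4 := hdiv _ _ h4 hs h0.ne'
  have k6 := hdiv _ _ h6 hs h0.ne'
  exact hdiv _ _ (((k2.fun_add h3).fun_sub ((k4.fun_add h5).const_mul 2)).fun_sub
    ((hs.const_mul 2).fun_mul (k6.fun_add h7))) ((hs.fun_add h8).const_mul 2) (by simpa using h1)

/-- This equation is the origin of `sprayFactor`: it is linear in `P`, with coefficient the norm of
`y`, and is solved for `P`. -/
lemma IsRandersPair.randersDiff_spray (h : IsRandersPair a b) (hy : y ≠ 0) :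
    randersDiff a b y (Q y y + sprayFactor a b a' b' Q T y • y + √(a y y) • T y)
      = (a' y y y / (2 * √(a y y)) + b' y y) / 2 := by
  have h0 := h.sqrt_pos hy
  have hL : √(a y y) + b y ≠ 0 := (h.norm_pos hy).ne'
  have hsq := h.sq_sqrt y
  have hP : sprayFactor a b a' b' Q T y * (2 * (√(a y y) + b y)) = _ :=
    div_mul_cancel₀ _ (mul_ne_zero two_ne_zero hL)
  have hd : randersDiff a b y (Q y y + sprayFactor a b a' b' Q T y • y + √(a y y) • T y)
      = a y (Q y y) / √(a y y) + b (Q y y) + sprayFactor a b a' b' Q T y * (√(a y y) + b y)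
        + √(a y y) * (a y (T y) / √(a y y) + b (T y)) := by
    simp only [randersDiff, map_add, map_smul, smul_eq_mul]
    have hPs : sprayFactor a b a' b' Q T y * a y y
        = sprayFactor a b a' b' Q T y * √(a y y) ^ 2 := by rw [hsq]
    rw [hPs]
    exact diff_identity h0.ne' _ _ _ _ _ _
  rw [hd]
  linarith

/-- The first summand of the fundamental form is settled by `randersDiff_spray`. The second
annihilates `y`, so `P` drops out of it, and the equations defining `Q` and `T` give what remains.
-/
lemma IsRandersPair.randersForm_spray (h : IsRandersPair a b) (hy : y ≠ 0)
    (hQ : ∀ w v, a (Q w w) v = (1 / 2) * a' w w v - (1 / 4) * a' v w w)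
    (hT : ∀ w v, a (T w) v = (1 / 2) * (b' w v - b' v w)) (v : V) :
    4 * randersForm a b y v (Q y y + sprayFactor a b a' b' Q T y • y + √(a y y) • T y)
      = 2 * ((a' y y y / (2 * √(a y y)) + b' y y) * randersDiff a b y v
      + randersNorm a b y * (a' y y v / √(a y y)
        - a y v * a' y y y / (2 * √(a y y) ^ 3) + b' y v
        - a' v y y / (2 * √(a y y)) - b' v y)) := by
  have h0 := h.sqrt_pos hy
  have hTy : a y (T y) = 0 := by rw [h.symm, hT]; ring
  have hQy : a y (Q y y) = (1 / 4) * a' y y y := by rw [h.symm, hQ]; ring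
  have e1 : a v (Q y y + sprayFactor a b a' b' Q T y • y + √(a y y) • T y)
      = (1 / 2) * a' y y v - (1 / 4) * a' v y y
      + sprayFactor a b a' b' Q T y * a y v + √(a y y) * ((1 / 2) * (b' y v - b' v y)) := by
    rw [h.symm, ← hQ, ← hT]
    simp only [map_add, map_smul, _root_.add_apply, _root_.smul_apply, smul_eq_mul]
  have e2 : a y (Q y y + sprayFactor a b a' b' Q T y • y + √(a y y) • T y)
      = (1 / 4) * a' y y y + sprayFactor a b a' b' Q T y * √(a y y) ^ 2 := by
    rw [h.sq_sqrt y]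
    simp only [map_add, map_smul, smul_eq_mul, hTy, hQy, mul_zero, add_zero]
  rw [randersForm, h.randersDiff_spray hy, e1, e2, randersDiff]
  exact form_identity h0.ne' _ _ _ _ _ _ _ _ _ _

end SprayFactor

variable {n : ℕ}
  {a : EuclideanSpace ℝ (Fin n) →
    EuclideanSpace ℝ (Fin n) →L[ℝ] EuclideanSpace ℝ (Fin n) →L[ℝ] ℝ}
  {b : EuclideanSpace ℝ (Fin n) → EuclideanSpace ℝ (Fin n) →L[ℝ] ℝ}
  {a' : EuclideanSpace ℝ (Fin n) →L[ℝ]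
    EuclideanSpace ℝ (Fin n) →L[ℝ] EuclideanSpace ℝ (Fin n) →L[ℝ] ℝ}
  {b' : EuclideanSpace ℝ (Fin n) →L[ℝ] EuclideanSpace ℝ (Fin n) →L[ℝ] ℝ}
  {u : EuclideanSpace ℝ (Fin n)}
  {Q : EuclideanSpace ℝ (Fin n) →L[ℝ] EuclideanSpace ℝ (Fin n) →L[ℝ] EuclideanSpace ℝ (Fin n)}
  {T : EuclideanSpace ℝ (Fin n) →L[ℝ] EuclideanSpace ℝ (Fin n)}

/-- The spray coefficients of a Randers metric `√a + b` are `Q(y, y) + P(y) y + √(a(y, y)) T y`,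
where `Q` is the spray of `a`, `T` represents half the exterior derivative of `b`, and `P` is
homogeneous of degree one. -/
lemma exists_sprayCoeff_eq (h : ∀ᶠ x in nhds u, IsRandersPair (a x) (b x))
    (ha : HasFDerivAt a a' u) (hb : HasFDerivAt b b' u)
    (hQ : ∀ w v, a u (Q w w) v = (1 / 2) * a' w w v - (1 / 4) * a' v w w)
    (hT : ∀ w v, a u (T w) v = (1 / 2) * (b' w v - b' v w)) :
    ∃ P : EuclideanSpace ℝ (Fin n) → ℝ,
      (∀ y, y ≠ 0 → ∃ P' : EuclideanSpace ℝ (Fin n) →L[ℝ] ℝ,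
        HasFDerivAt P P' y ∧ P' y = P y) ∧
      ∀ y, y ≠ 0 → ∀ i, sprayCoeff (fun x w => randersNorm (a x) (b x) w) u i y
        = Q y y i + P y * y i + √(a u y y) * T y i := by
  have hu := h.self_of_nhds
  refine ⟨sprayFactor (a u) (b u) a' b' Q T, fun y hy => ?_, fun y hy i => ?_⟩
  · have hd := (hu.differentiableAt_sprayFactor (a' := a') (b' := b') (Q := Q) (T := T)
      hy).hasFDerivAt
    exact ⟨_, hd, hasFDerivAt_apply_self_of_homogeneous hd fun t ht => sprayFactor_smul ht⟩
  · rw [sprayCoeff_eq_of_forall h ha hb hy (hu.randersForm_spray hy hQ hT)]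
    rfl

/-- The Douglas tensor of a Randers metric is the third derivative of `√a · T`. -/
lemma douglasTensor_randersNorm (h : ∀ᶠ x in nhds u, IsRandersPair (a x) (b x))
    (ha : HasFDerivAt a a' u) (hb : HasFDerivAt b b' u)
    (hQ : ∀ w v, a u (Q w w) v = (1 / 2) * a' w w v - (1 / 4) * a' v w w)
    (hT : ∀ w v, a u (T w) v = (1 / 2) * (b' w v - b' v w))
    {y : EuclideanSpace ℝ (Fin n)} (hy : y ≠ 0) (i j k l : Fin n) :
    douglasTensor (fun x w => randersNorm (a x) (b x) w) u i j k l y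
      = thirdDiffSqrtMul (a u) (EuclideanSpace.proj i ∘L T) y (EuclideanSpace.single j 1)
        (EuclideanSpace.single k 1) (EuclideanSpace.single l 1) := by
  have hu := h.self_of_nhds
  obtain ⟨P, hP, hG⟩ := exists_sprayCoeff_eq h ha hb hQ hT
  let q : Fin n → EuclideanSpace ℝ (Fin n) →L[ℝ] EuclideanSpace ℝ (Fin n) →L[ℝ] ℝ := fun m =>
    ContinuousLinearMap.compL ℝ (EuclideanSpace ℝ (Fin n)) (EuclideanSpace ℝ (Fin n)) ℝ
      (EuclideanSpace.proj m) ∘L Q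
  have hq : ∀ m v w, q m v w = Q v w m := fun m v w => rfl
  let c : EuclideanSpace ℝ (Fin n) →L[ℝ] ℝ :=
    ∑ m, (q m + (q m).flip) (EuclideanSpace.single m 1)
  have htr : ∑ m : Fin n, T (EuclideanSpace.single m 1) m = 0 :=
    sum_apply_single_eq_zero_of_skew hu.symm hu.pos fun v w => by rw [hT, hT]; ring
  -- The divergence of `P(w) w` is `P'(w) + n P = (n + 1) P`; that of `√a T` is `a(w, T w)/√a + √a
  -- tr T = 0`.
  have hdiv : ∀ w, w ≠ 0 → ∑ m : Fin n, partialD m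
      (sprayCoeff (fun x w => randersNorm (a x) (b x) w) u m) w = c w + (n + 1) * P w := by
    intro w hw
    obtain ⟨P', hP', hPw⟩ := hP w hw
    have h0 := hu.sqrt_pos hw
    have h1 : ∀ m : Fin n, partialD m
        (sprayCoeff (fun x w => randersNorm (a x) (b x) w) u m) w
        = (q m + (q m).flip) (EuclideanSpace.single m 1) w
          + w m * P' (EuclideanSpace.single m 1) + P w
          + T w m * ((√(a u w w))⁻¹ * a u w (EuclideanSpace.single m 1))
          + √(a u w w) * T (EuclideanSpace.single m 1) m := by
      intro m
      have hd := ((hasFDerivAt_bilin_self (q m) w).add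
        (hP'.mul (EuclideanSpace.proj (𝕜 := ℝ) m).hasFDerivAt)).add
          ((hu.hasFDerivAt_sqrt hw).mul (EuclideanSpace.proj (𝕜 := ℝ) m ∘L T).hasFDerivAt)
      rw [partialD_eq_of_hasFDerivAt (hd.congr_of_eventuallyEq ?_)]
      · simp
        ring
      · filter_upwards [isOpen_ne.mem_nhds hw] with x hx
        exact hG x hx m
    have h2 : ∑ m : Fin n, T w m * ((√(a u w w))⁻¹ * a u w (EuclideanSpace.single m 1)) = 0 := by
      have := sum_coord_mul_apply_single ((√(a u w w))⁻¹ • a u w) (T w)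
      simp only [_root_.smul_apply, smul_eq_mul] at this
      rw [this, hu.symm _ (T w), hT]
      ring
    simp_rw [h1, Finset.sum_add_distrib]
    rw [sum_coord_mul_apply_single, h2, ← Finset.mul_sum, htr, hPw]
    simp [c]
    ring
  rw [douglasTensor]
  refine partialD_three_sqrt_mul hu
    (q i - (1 / ((n : ℝ) + 1)) • c.smulRight (EuclideanSpace.proj (𝕜 := ℝ) i)) _
    (fun w hw => ?_) hy j k l
  have hn : (n : ℝ) + 1 ≠ 0 := by positivity
  rw [hG w hw, hdiv w hw]
  simp [hq]
  field_simp
  ring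

/-- The Douglas tensor of a Randers metric vanishes at a point if and only if the exterior
derivative of the linear form does. -/
theorem douglasTensor_randersNorm_eq_zero_iff (h : ∀ᶠ x in nhds u, IsRandersPair (a x) (b x))
    (ha : HasFDerivAt a a' u) (hb : HasFDerivAt b b' u) :
    (∀ y : EuclideanSpace ℝ (Fin n), y ≠ 0 → ∀ i j k l : Fin n,
      douglasTensor (fun x w => randersNorm (a x) (b x) w) u i j k l y = 0) ↔
    ∀ v w, b' v w = b' w v := by
  have hu := h.self_of_nhds
  obtain ⟨Q, T, hQ, hT⟩ := exists_spray_parts hu.pos a' b'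
  constructor
  · intro H v w
    rcases eq_or_ne v 0 with rfl | hv
    · simp
    -- If no such `y` exists, every `w` is a multiple of `v`, and symmetry of `b'` on multiples of
    -- `v` is automatic.
    by_cases hex : ∃ y, y ≠ 0 ∧ a u y v = 0
    · obtain ⟨y, hy, hyv⟩ := hex
      have hTv : T v = 0 := by
        ext i
        have := eq_zero_of_thirdDiffSqrtMul (τ := EuclideanSpace.proj i ∘L T) hu hy hv hyv
          fun j k l => by
            rw [← douglasTensor_randersNorm h ha hb hQ hT hy]
            exact H y hy i j k l
        simpa using this
      have := hT v w
      rw [hTv] at this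
      simp at this
      linarith
    · push Not at hex
      have hpos := hu.pos v hv
      have hw : w - (a u w v / a u v v) • v = 0 := by
        by_contra hne
        refine hex _ hne ?_
        simp
        field_simp
        ring
      rw [sub_eq_zero.1 hw]
      simp
  · intro H y hy i j k l
    rw [douglasTensor_randersNorm h ha hb hQ hT hy]
    have hT0 : T = 0 := by
      ext1 w
      by_contra hne
      have := hu.pos (T w) hne
      rw [hT, H] at this
      simp at this
    simp [hT0, thirdDiffSqrtMul]

end DouglasRanders

/-! ### Coordinate expressions of forms, fields, metrics and the exterior derivative. -/

section Chart

variable {n : ℕ} {M : Type*} [TopologicalSpace M] [ChartedSpace (EuclideanSpace ℝ (Fin n)) M]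

/-- The differential at `u` of the inverse of a chart `e`. -/
def chartDiff (e : OpenPartialHomeomorph M (EuclideanSpace ℝ (Fin n)))
    (u : EuclideanSpace ℝ (Fin n)) :
    EuclideanSpace ℝ (Fin n) →L[ℝ] TangentSpace (𝓡 n) (e.symm u) :=
  mfderiv (𝓡 n) (𝓡 n) e.symm u

/-- The coordinate expression of a 1-form. -/
def localForm (β : (x : M) → TangentSpace (𝓡 n) x →L[ℝ] ℝ)
    (e : OpenPartialHomeomorph M (EuclideanSpace ℝ (Fin n)))
    (u : EuclideanSpace ℝ (Fin n)) : EuclideanSpace ℝ (Fin n) →L[ℝ] ℝ :=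
  (β (e.symm u)).comp (chartDiff e u)

variable {e : OpenPartialHomeomorph M (EuclideanSpace ℝ (Fin n))}
  {u : EuclideanSpace ℝ (Fin n)}

lemma mdifferentiable_of_mem_maximalAtlas (he : e ∈ IsManifold.maximalAtlas (𝓡 n) ∞ M) :
    e.MDifferentiable (𝓡 n) (𝓡 n) :=
  ⟨(contMDiffOn_of_mem_maximalAtlas he).mdifferentiableOn (by simp),
    (contMDiffOn_symm_of_mem_maximalAtlas he).mdifferentiableOn (by simp)⟩

lemma isInvertible_chartDiff (he : e ∈ IsManifold.maximalAtlas (𝓡 n) ∞ M) (hu : u ∈ e.target) :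
    (chartDiff e u).IsInvertible :=
  ⟨(mdifferentiable_of_mem_maximalAtlas he).symm.mfderiv hu, rfl⟩

/-- The coordinate expression of a vector field. -/
def localField (Y : (x : M) → TangentSpace (𝓡 n) x)
    (e : OpenPartialHomeomorph M (EuclideanSpace ℝ (Fin n)))
    (u : EuclideanSpace ℝ (Fin n)) : EuclideanSpace ℝ (Fin n) :=
  VectorField.mpullback (𝓡 n) (𝓡 n) e.symm Y u

lemma chartDiff_localField (he : e ∈ IsManifold.maximalAtlas (𝓡 n) ∞ M) (hu : u ∈ e.target)
    (Y : (x : M) → TangentSpace (𝓡 n) x) : chartDiff e u (localField Y e u) = Y (e.symm u) :=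
  (isInvertible_chartDiff he hu).self_apply_inverse _

lemma dirDeriv_eq_fderiv (he : e ∈ IsManifold.maximalAtlas (𝓡 n) ∞ M) (hu : u ∈ e.target)
    (Y : (x : M) → TangentSpace (𝓡 n) x) {h : M → ℝ}
    (hh : MDifferentiableAt (𝓡 n) 𝓘(ℝ, ℝ) h (e.symm u)) :
    dirDeriv Y h (e.symm u) = fderiv ℝ (fun u' => h (e.symm u')) u (localField Y e u) := by
  have h1 := mfderiv_comp u hh
    ((mdifferentiable_of_mem_maximalAtlas he).mdifferentiableAt_symm hu)
  rw [mfderiv_eq_fderiv] at h1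
  have h2 : fderiv ℝ (fun u' => h (e.symm u')) u = _ := h1
  rw [h2, dirDeriv, ← chartDiff_localField he hu Y]
  rfl

variable [IsManifold (𝓡 n) ∞ M]

/-- The coordinate expression of a Riemannian metric. -/
def localInner (g : RiemMetric n M)
    (e : OpenPartialHomeomorph M (EuclideanSpace ℝ (Fin n)))
    (u : EuclideanSpace ℝ (Fin n)) :
    EuclideanSpace ℝ (Fin n) →L[ℝ] EuclideanSpace ℝ (Fin n) →L[ℝ] ℝ :=
  (ContinuousLinearMap.precomp ℝ (chartDiff e u)).comp
    ((g.inner (e.symm u)).comp (chartDiff e u))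

/-- The tangent map of `e.symm` applied to a constant field. Pairing with these fields reduces
smoothness of local tensors to smoothness of scalar functions. -/
lemma contMDiffOn_chartDiff (he : e ∈ IsManifold.maximalAtlas (𝓡 n) ∞ M)
    (v : EuclideanSpace ℝ (Fin n)) :
    ContMDiffOn (𝓡 n) (𝓡 n).tangent ∞
      (fun u => (⟨e.symm u, chartDiff e u v⟩ : TangentBundle (𝓡 n) M)) e.target := by
  have h1 : ContMDiff (𝓡 n) (𝓡 n).tangent ∞
      (fun u : EuclideanSpace ℝ (Fin n) =>
        (⟨u, v⟩ : TangentBundle (𝓡 n) (EuclideanSpace ℝ (Fin n)))) := fun u =>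
    contMDiffAt_vectorSpace_iff_contDiffAt.2 contDiffAt_const
  have h2 := (contMDiffOn_symm_of_mem_maximalAtlas he).contMDiffOn_tangentMapWithin (m := ∞)
    (by simp) e.open_target.uniqueMDiffOn
  refine (h2.comp h1.contMDiffOn fun u hu => hu).congr fun u hu => ?_
  simp only [Function.comp, tangentMapWithin, mfderivWithin_of_isOpen e.open_target hu]
  rfl

lemma contDiffOn_localForm (he : e ∈ IsManifold.maximalAtlas (𝓡 n) ∞ M)
    {β : (x : M) → TangentSpace (𝓡 n) x →L[ℝ] ℝ} (hβ : IsSmoothOneForm β) :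
    ContDiffOn ℝ ∞ (localForm β e) e.target := by
  rw [contDiffOn_clm_apply]
  intro v
  have h1 := hβ.comp_contMDiffOn (contMDiffOn_symm_of_mem_maximalAtlas he)
  have h2 : ContMDiffOn (𝓡 n) ((𝓡 n).prod 𝓘(ℝ, ℝ)) ∞
      (fun u => TotalSpace.mk' ℝ (E := Bundle.Trivial M ℝ) (e.symm u)
        (β (e.symm u) (chartDiff e u v))) e.target :=
    ContMDiffOn.clm_bundle_apply (F₁ := EuclideanSpace ℝ (Fin n)) h1 (contMDiffOn_chartDiff he v)
  intro u hu
  have h3 := h2 u hu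
  simp only [contMDiffWithinAt_totalSpace] at h3
  exact h3.2.contDiffWithinAt

lemma contDiffOn_localInner (he : e ∈ IsManifold.maximalAtlas (𝓡 n) ∞ M) (g : RiemMetric n M) :
    ContDiffOn ℝ ∞ (localInner g e) e.target := by
  rw [contDiffOn_clm_apply]
  intro v
  rw [contDiffOn_clm_apply]
  intro w
  have h1 := g.contMDiff.comp_contMDiffOn (contMDiffOn_symm_of_mem_maximalAtlas he)
  have h2 : ContMDiffOn (𝓡 n) ((𝓡 n).prod 𝓘(ℝ, ℝ)) ∞
      (fun u => TotalSpace.mk' ℝ (E := Bundle.Trivial M ℝ) (e.symm u)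
        (g.inner (e.symm u) (chartDiff e u v) (chartDiff e u w))) e.target :=
    ContMDiffOn.clm_bundle_apply₂ (F₁ := EuclideanSpace ℝ (Fin n))
      (F₂ := EuclideanSpace ℝ (Fin n)) h1 (contMDiffOn_chartDiff he v) (contMDiffOn_chartDiff he w)
  intro u hu
  have h3 := h2 u hu
  simp only [contMDiffWithinAt_totalSpace] at h3
  exact h3.2.contDiffWithinAt

lemma differentiableAt_localField (he : e ∈ IsManifold.maximalAtlas (𝓡 n) ∞ M) (hu : u ∈ e.target)
    {Y : (x : M) → TangentSpace (𝓡 n) x} (hY : IsSmoothField Y) :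
    DifferentiableAt ℝ (localField Y e) u := by
  have h1 : ContMDiffAt (𝓡 n) (𝓡 n).tangent 1 (fun x => (⟨x, Y x⟩ : TangentBundle (𝓡 n) M))
      (e.symm u) := (hY _).of_le (by simp)
  have h2 := h1.mpullback_vectorField_preimage (n := ∞)
    (contMDiffAt_symm_of_mem_maximalAtlas he hu) (isInvertible_chartDiff he hu)
    (by norm_cast)
  exact (contMDiffAt_vectorSpace_iff_contDiffAt.1 h2).differentiableAt one_ne_zero

lemma mdifferentiableAt_apply {β : (x : M) → TangentSpace (𝓡 n) x →L[ℝ] ℝ}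
    (hβ : IsSmoothOneForm β) {Y : (x : M) → TangentSpace (𝓡 n) x} (hY : IsSmoothField Y) (x : M) :
    MDifferentiableAt (𝓡 n) 𝓘(ℝ, ℝ) (fun p => β p (Y p)) x := by
  have h2 : ContMDiffAt (𝓡 n) ((𝓡 n).prod 𝓘(ℝ, ℝ)) ∞
      (fun u => TotalSpace.mk' ℝ (E := Bundle.Trivial M ℝ) u (β u (Y u))) x :=
    ContMDiffAt.clm_bundle_apply (F₁ := EuclideanSpace ℝ (Fin n)) (hβ x) (hY x)
  simp only [contMDiffAt_totalSpace] at h2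
  exact h2.2.mdifferentiableAt (by simp)

/-- The exterior derivative in a chart. -/
lemma extD_eq_fderiv_localForm (he : e ∈ IsManifold.maximalAtlas (𝓡 n) ∞ M) (hu : u ∈ e.target)
    {β : (x : M) → TangentSpace (𝓡 n) x →L[ℝ] ℝ} (hβ : IsSmoothOneForm β)
    {Y Z : (x : M) → TangentSpace (𝓡 n) x} (hY : IsSmoothField Y) (hZ : IsSmoothField Z) :
    extD β Y Z (e.symm u)
      = fderiv ℝ (localForm β e) u (localField Y e u) (localField Z e u)
        - fderiv ℝ (localForm β e) u (localField Z e u) (localField Y e u) := by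
  have hB : DifferentiableAt ℝ (localForm β e) u :=
    ((contDiffOn_localForm he hβ).contDiffAt (e.open_target.mem_nhds hu)).differentiableAt
      (by simp)
  -- Product rule in the chart. The terms that differentiate the fields are cancelled by the bracket
  -- in `hbr`.
  have key : ∀ {Y Z : (x : M) → TangentSpace (𝓡 n) x}, IsSmoothField Y → IsSmoothField Z →
      dirDeriv Y (fun p => β p (Z p)) (e.symm u)
        = localForm β e u (fderiv ℝ (localField Z e) u (localField Y e u))
          + fderiv ℝ (localForm β e) u (localField Y e u) (localField Z e u) := by
    intro Y Z hY hZ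
    rw [dirDeriv_eq_fderiv he hu Y (mdifferentiableAt_apply hβ hZ _)]
    have h1 : (fun u' => β (e.symm u') (Z (e.symm u'))) =ᶠ[nhds u]
        fun u' => localForm β e u' (localField Z e u') := by
      filter_upwards [e.open_target.mem_nhds hu] with x hx
      rw [← chartDiff_localField he hx Z]
      rfl
    rw [h1.fderiv_eq, fderiv_clm_apply hB (differentiableAt_localField he hu hZ)]
    simp
  have hbr : β (e.symm u) (VectorField.mlieBracket (𝓡 n) Y Z (e.symm u))
      = localForm β e u (fderiv ℝ (localField Z e) u (localField Y e u)
        - fderiv ℝ (localField Y e) u (localField Z e u)) := by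
    have h0 : minSmoothness ℝ 2 ≤ ∞ := by
      rw [minSmoothness_of_isRCLikeNormedField]
      exact ENat.LEInfty.out
    have : IsManifold (𝓡 n) (minSmoothness ℝ 2) M := IsManifold.of_le h0
    have h1 := VectorField.mpullback_mlieBracket (n := ∞) (x₀ := u)
      ((hY (e.symm u)).mdifferentiableAt (by simp)) ((hZ (e.symm u)).mdifferentiableAt (by simp))
      (contMDiffAt_symm_of_mem_maximalAtlas he hu) h0
    have h2 : localField (VectorField.mlieBracket (𝓡 n) Y Z) e u
        = VectorField.lieBracket ℝ (localField Y e) (localField Z e) u := by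
      rw [localField, h1, ← VectorField.mlieBracketWithin_univ]
      refine (congrFun VectorField.mlieBracketWithin_eq_lieBracketWithin u).trans ?_
      exact congrFun VectorField.lieBracketWithin_univ u
    rw [← chartDiff_localField he hu (VectorField.mlieBracket (𝓡 n) Y Z), h2]
    rfl
  rw [extD, key hY hZ, key hZ hY, hbr, map_sub]
  ring

/-- Each tangent vector is the value of a smooth vector field. -/
lemma exists_isSmoothField_apply_eq [T2Space M] (x : M) (v : TangentSpace (𝓡 n) x) :
    ∃ Y : (x : M) → TangentSpace (𝓡 n) x, IsSmoothField Y ∧ Y x = v := by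
  obtain ⟨s, hs, hsm⟩ := FiberBundle.exists_contMDiffOn_extend (𝓡 n) (k := ∞)
    (EuclideanSpace ℝ (Fin n)) (V := fun x : M => TangentSpace (𝓡 n) x) v
  -- A bump function equal to one at `x`, supported where the local extension of `v` is smooth,
  -- makes that extension global.
  obtain ⟨ψ, -, hψ⟩ := (SmoothBumpFunction.nhds_basis_tsupport (I := 𝓡 n) x).mem_iff.1
    (interior_mem_nhds.2 hs)
  refine ⟨(ψ : M → ℝ) • FiberBundle.extend (EuclideanSpace ℝ (Fin n)) v,
    ContMDiffOn.smul_section_of_tsupport ψ.contMDiff.contMDiffOn isOpen_interior hψ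
      (hsm.mono interior_subset), ?_⟩
  simp

end Chart

/-! ### Conformal scaling and strong convexity of Randers norms. -/

section Conformal

variable {V : Type*} [NormedAddCommGroup V] [NormedSpace ℝ V]
  {a : V →L[ℝ] V →L[ℝ] ℝ} {b : V →L[ℝ] ℝ}

lemma differentiableAt_smul {W : Type*} [NormedAddCommGroup W] [NormedSpace ℝ W] {c : V → ℝ}
    {h : V → W} {x : V} (hc : DifferentiableAt ℝ c x) (hh : DifferentiableAt ℝ h x) :
    DifferentiableAt ℝ (fun x => c x • h x) x :=
  hc.smul hh

lemma sqrt_sq_mul_of_pos {r : ℝ} (hr : 0 < r) (s : ℝ) : √(r ^ 2 * s) = r * √s := by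
  rw [Real.sqrt_mul (sq_nonneg r), Real.sqrt_sq hr.le]

/-- The form and the length both scale by `r`, so the same bound `c` works; it is used with `r =
e^f`. -/
lemma IsRandersPair.smul (h : IsRandersPair a b) {r : ℝ} (hr : 0 < r) :
    IsRandersPair (r ^ 2 • a) (r • b) where
  symm v w := by simp [h.symm v w]
  pos v hv := by
    have := h.pos v hv
    simp only [_root_.smul_apply, smul_eq_mul]
    positivity
  norm_lt_one := by
    obtain ⟨c, hc, hb⟩ := h.norm_lt_one
    refine ⟨c, hc, fun v => ?_⟩
    simp only [_root_.smul_apply, smul_eq_mul]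
    rw [sqrt_sq_mul_of_pos hr, abs_mul, abs_of_pos hr]
    nlinarith [hb v]

lemma randersNorm_conformal {r : ℝ} (hr : 0 < r) (y : V) :
    randersNorm (r ^ 2 • a) (r • b) y = r * (√(a y y) + b y) := by
  simp only [randersNorm, _root_.smul_apply, smul_eq_mul]
  rw [sqrt_sq_mul_of_pos hr]
  ring

/-- The second derivative of the square of a Randers norm along a line is positive. -/
lemma IsRandersPair.half_iteratedDeriv_sq_pos (h : IsRandersPair a b) {y v : V} (hy : y ≠ 0)
    (hv : v ≠ 0) :
    0 < (1 / 2) * iteratedDeriv 2 (fun t : ℝ => randersNorm a b (y + t • v) ^ 2) 0 := by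
  have hline : ∀ t : ℝ, HasDerivAt (fun s : ℝ => y + s • v) v t := fun t => by
    simpa using ((hasDerivAt_id t).smul_const v).const_add y
  have hne : ∀ᶠ t : ℝ in nhds 0, y + t • v ≠ 0 :=
    (hline 0).continuousAt.eventually_ne (by simpa using hy)
  have h1 : deriv (fun t : ℝ => randersNorm a b (y + t • v) ^ 2) =ᶠ[nhds 0] fun t =>
      2 * (randersNorm a b (y + t • v) * randersDiff a b (y + t • v) v) := by
    filter_upwards [hne] with t ht
    refine (((h.hasFDerivAt_norm ht).comp_hasDerivAt t (hline t)).pow 2).deriv.trans ?_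
    simp [randersDiff]
    ring
  obtain ⟨φ, hφ, hd⟩ := h.hasFDerivAt_norm_mul_diff hy v
  have h2 : HasDerivAt (fun t : ℝ =>
      2 * (randersNorm a b (y + t • v) * randersDiff a b (y + t • v) v)) (2 * φ v) 0 :=
    (HasFDerivAt.comp_hasDerivAt (f := fun t : ℝ => y + t • v) 0 (by simpa using hd)
      (hline 0)).const_mul 2
  rw [iteratedDeriv_succ, iteratedDeriv_one, h1.deriv_eq, h2.deriv, hφ]
  have := h.form_pos hy hv
  linarith

end Conformal

/-! ### The conformal Randers metric on the manifold and in charts. -/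

section Main

variable {n : ℕ} {M : Type*} [TopologicalSpace M] [ChartedSpace (EuclideanSpace ℝ (Fin n)) M]
  [IsManifold (𝓡 n) ∞ M]
  {g : RiemMetric n M} {β : (x : M) → TangentSpace (𝓡 n) x →L[ℝ] ℝ}
  {e : OpenPartialHomeomorph M (EuclideanSpace ℝ (Fin n))} {u : EuclideanSpace ℝ (Fin n)}

lemma isRandersPair_inner (hβ : DualNormLTOne g β) (x : M) :
    IsRandersPair (V := EuclideanSpace ℝ (Fin n)) (g.inner x) (β x) where
  symm := g.symm x
  pos := g.pos x
  norm_lt_one := hβ x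

lemma isRandersPair_local (he : e ∈ IsManifold.maximalAtlas (𝓡 n) ∞ M) (hu : u ∈ e.target)
    (hβ : DualNormLTOne g β) : IsRandersPair (localInner g e u) (localForm β e u) where
  symm v w := g.symm _ _ _
  pos v hv := g.pos _ _ fun h0 => hv
    ((isInvertible_chartDiff he hu).injective (h0.trans (map_zero (chartDiff e u)).symm))
  norm_lt_one := by
    obtain ⟨c, hc, hb⟩ := hβ (e.symm u)
    exact ⟨c, hc, fun v => hb _⟩

lemma contMDiff_tangent_apply_form (hβ : IsSmoothOneForm β) :
    ContMDiff (𝓡 n).tangent 𝓘(ℝ, ℝ) ∞ (fun p : TangentBundle (𝓡 n) M => β p.1 p.2) := by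
  have h1 := hβ.comp (contMDiff_proj (F := EuclideanSpace ℝ (Fin n))
    (TangentSpace (𝓡 n) : M → Type _))
  have h2 : ContMDiff (𝓡 n).tangent ((𝓡 n).prod 𝓘(ℝ, ℝ)) ∞
      (fun p : TangentBundle (𝓡 n) M =>
        TotalSpace.mk' ℝ (E := Bundle.Trivial M ℝ) p.1 (β p.1 p.2)) :=
    ContMDiff.clm_bundle_apply (F₁ := EuclideanSpace ℝ (Fin n)) h1 contMDiff_id
  intro p
  have h3 := h2 p
  simp only [contMDiffAt_totalSpace] at h3
  exact h3.2

lemma contMDiff_tangent_inner (g : RiemMetric n M) :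
    ContMDiff (𝓡 n).tangent 𝓘(ℝ, ℝ) ∞
      (fun p : TangentBundle (𝓡 n) M => g.inner p.1 p.2 p.2) := by
  have h1 := g.contMDiff.comp (contMDiff_proj (F := EuclideanSpace ℝ (Fin n))
    (TangentSpace (𝓡 n) : M → Type _))
  have h2 : ContMDiff (𝓡 n).tangent ((𝓡 n).prod 𝓘(ℝ, ℝ)) ∞
      (fun p : TangentBundle (𝓡 n) M =>
        TotalSpace.mk' ℝ (E := Bundle.Trivial M ℝ) p.1 (g.inner p.1 p.2 p.2)) :=
    ContMDiff.clm_bundle_apply₂ (F₁ := EuclideanSpace ℝ (Fin n))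
      (F₂ := EuclideanSpace ℝ (Fin n)) h1 contMDiff_id contMDiff_id
  intro p
  have h3 := h2 p
  simp only [contMDiffAt_totalSpace] at h3
  exact h3.2

/-- A metric that is conformal to a Randers metric is a Finsler metric. -/
lemma isFinslerMetric_conformal_randers {F F' : (x : M) → TangentSpace (𝓡 n) x → ℝ}
    (hF : IsRandersMetric F g β) {f : M → ℝ} (hf : ContMDiff (𝓡 n) 𝓘(ℝ, ℝ) ∞ f)
    (hF' : ∀ (x : M) (y : TangentSpace (𝓡 n) x), F' x y = Real.exp (f x) * F x y) :
    IsFinslerMetric F' := by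
  have hpair := fun x => (isRandersPair_inner hF.norm_lt_one x).smul (Real.exp_pos (f x))
  have hnorm : ∀ x y, F' x y = randersNorm (V := EuclideanSpace ℝ (Fin n)) _ _ y := fun x y => by
    rw [hF', hF.eq_add]
    exact (randersNorm_conformal (V := EuclideanSpace ℝ (Fin n)) (a := g.inner x) (b := β x)
      (Real.exp_pos (f x)) y).symm
  refine ⟨?_, fun x y c hc => ?_, fun x y hy => ?_, fun x y v hy hv => ?_⟩
  · have h1 : ContMDiff (𝓡 n).tangent 𝓘(ℝ, ℝ) ∞
        (fun p : TangentBundle (𝓡 n) M => Real.exp (f p.1)) :=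
      Real.contDiff_exp.contMDiff.comp
        (hf.comp (contMDiff_proj (F := EuclideanSpace ℝ (Fin n))
    (TangentSpace (𝓡 n) : M → Type _)))
    intro p hp
    have hpos := g.pos p.1 p.2 hp
    have h2 : ContMDiffAt (𝓡 n).tangent 𝓘(ℝ, ℝ) ∞
        (fun p : TangentBundle (𝓡 n) M => √(g.inner p.1 p.2 p.2)) p :=
      (Real.contDiffAt_sqrt hpos.ne').contMDiffAt.comp p (contMDiff_tangent_inner g p)
    refine ContMDiffAt.contMDiffWithinAt ?_
    refine ((h1 p).mul (h2.add (contMDiff_tangent_apply_form hF.smooth_form p))).congr_of_eventuallyEq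
      (Filter.Eventually.of_forall fun q => ?_)
    simp only [hF', hF.eq_add]
    rfl
  · rw [hnorm, hnorm]
    exact randersNorm_smul (V := EuclideanSpace ℝ (Fin n)) hc y
  · rw [hnorm]
    exact (hpair x).norm_pos hy
  · simp_rw [hnorm]
    exact (hpair x).half_iteratedDeriv_sq_pos hy hv

/-- An algebraic identity, valid even off the target of `e`, so `localExpr F'` can be rewritten as a
function before any differentiation. -/
lemma localExpr_conformal_randers {F F' : (x : M) → TangentSpace (𝓡 n) x → ℝ}
    (hF : IsRandersMetric F g β) {f : M → ℝ}
    (hF' : ∀ (x : M) (y : TangentSpace (𝓡 n) x), F' x y = Real.exp (f x) * F x y)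
    (e : OpenPartialHomeomorph M (EuclideanSpace ℝ (Fin n))) :
    localExpr F' e = fun u y => randersNorm (Real.exp (f (e.symm u)) ^ 2 • localInner g e u)
      (Real.exp (f (e.symm u)) • localForm β e u) y := by
  ext u y
  rw [randersNorm_conformal (Real.exp_pos _), localExpr, hF', hF.eq_add]
  rfl

/-- The exterior derivative of `exp(f) β` in a chart. -/
lemma fderiv_exp_smul_localForm (he : e ∈ IsManifold.maximalAtlas (𝓡 n) ∞ M) (hu : u ∈ e.target)
    (hβ : IsSmoothOneForm β) {f : M → ℝ} (hf : ContMDiff (𝓡 n) 𝓘(ℝ, ℝ) ∞ f) :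
    ∃ b' : EuclideanSpace ℝ (Fin n) →L[ℝ] EuclideanSpace ℝ (Fin n) →L[ℝ] ℝ,
      HasFDerivAt (fun x => Real.exp (f (e.symm x)) • localForm β e x) b' u ∧
      ∀ Y Z : (x : M) → TangentSpace (𝓡 n) x, IsSmoothField Y → IsSmoothField Z →
        b' (localField Y e u) (localField Z e u) - b' (localField Z e u) (localField Y e u)
          = Real.exp (f (e.symm u)) * (extD β Y Z (e.symm u)
            + dirDeriv Y f (e.symm u) * β (e.symm u) (Z (e.symm u))
            - dirDeriv Z f (e.symm u) * β (e.symm u) (Y (e.symm u))) := by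
  have hfe : DifferentiableAt ℝ (fun x => f (e.symm x)) u :=
    mdifferentiableAt_iff_differentiableAt.1 ((hf.mdifferentiable (by simp) _).comp u
      ((mdifferentiable_of_mem_maximalAtlas he).mdifferentiableAt_symm hu))
  have hB : DifferentiableAt ℝ (localForm β e) u :=
    ((contDiffOn_localForm he hβ).contDiffAt (e.open_target.mem_nhds hu)).differentiableAt
      (by simp)
  refine ⟨_, hfe.hasFDerivAt.exp.smul hB.hasFDerivAt, fun Y Z hY hZ => ?_⟩
  rw [extD_eq_fderiv_localForm he hu hβ hY hZ,
    dirDeriv_eq_fderiv he hu Y (hf.mdifferentiable (by simp) _),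
    dirDeriv_eq_fderiv he hu Z (hf.mdifferentiable (by simp) _),
    ← chartDiff_localField he hu Y, ← chartDiff_localField he hu Z]
  have hform : ∀ v, β (e.symm u) (chartDiff e u v) = localForm β e u v := fun v => rfl
  simp [hform]
  ring

end Main

end FinslerDouglas

end

theorem proposition2p5 {n : ℕ} {M : Type*} [TopologicalSpace M] [T2Space M]
    [ChartedSpace (EuclideanSpace ℝ (Fin n)) M]
    [IsManifold (𝓡 n) ∞ M]
    (g : FinslerDouglas.RiemMetric n M)
    (β : (x : M) → TangentSpace (𝓡 n) x →L[ℝ] ℝ)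
    (F : (x : M) → TangentSpace (𝓡 n) x → ℝ)
    (hF : FinslerDouglas.IsRandersMetric F g β)
    -- the vector field that corresponds to the 1-form with respect to the Riemannian metric
    (X : (x : M) → TangentSpace (𝓡 n) x)
    (hX : ∀ (x : M) (v : TangentSpace (𝓡 n) x), β x v = g.inner x (X x) v)
    (f : M → ℝ) (hf : ContMDiff (𝓡 n) 𝓘(ℝ, ℝ) ∞ f)
    (F' : (x : M) → TangentSpace (𝓡 n) x → ℝ)
    (hF' : ∀ (x : M) (y : TangentSpace (𝓡 n) x), F' x y = Real.exp (f x) * F x y) :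
    FinslerDouglas.IsDouglasMetric F' ↔
      ∀ Y Z : (x : M) → TangentSpace (𝓡 n) x,
        FinslerDouglas.IsSmoothField Y → FinslerDouglas.IsSmoothField Z → ∀ x : M,
          FinslerDouglas.extD β Y Z x
            + FinslerDouglas.dirDeriv Y f x * g.inner x (X x) (Z x)
            - FinslerDouglas.dirDeriv Z f x * g.inner x (X x) (Y x) = 0 := by
  open FinslerDouglas in
  simp_rw [← hX]
  -- The equivalence holds point by point in every chart, both sides meaning that `e^f β` is closed
  -- at that point.
  have key : ∀ e ∈ IsManifold.maximalAtlas (𝓡 n) ∞ M, ∀ u ∈ e.target,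
      ((∀ y : EuclideanSpace ℝ (Fin n), y ≠ 0 → ∀ i j k l : Fin n,
        douglasTensor (localExpr F' e) u i j k l y = 0) ↔
      ∀ Y Z : (x : M) → TangentSpace (𝓡 n) x, IsSmoothField Y → IsSmoothField Z →
        extD β Y Z (e.symm u) + dirDeriv Y f (e.symm u) * β (e.symm u) (Z (e.symm u))
          - dirDeriv Z f (e.symm u) * β (e.symm u) (Y (e.symm u)) = 0) := by
    intro e he u hu
    obtain ⟨b', hb', hext⟩ := fderiv_exp_smul_localForm he hu hF.smooth_form hf
    have ha : DifferentiableAt ℝ (fun x => Real.exp (f (e.symm x)) ^ 2 • localInner g e x) u := by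
      have hfe : DifferentiableAt ℝ (fun x => f (e.symm x)) u :=
        mdifferentiableAt_iff_differentiableAt.1 ((hf.mdifferentiable (by simp) _).comp u
          ((mdifferentiable_of_mem_maximalAtlas he).mdifferentiableAt_symm hu))
      exact differentiableAt_smul (hfe.exp.pow 2) (((contDiffOn_localInner he g).contDiffAt
        (e.open_target.mem_nhds hu)).differentiableAt (by simp))
    have hpair : ∀ᶠ x in nhds u, IsRandersPair
        (Real.exp (f (e.symm x)) ^ 2 • localInner g e x)
        (Real.exp (f (e.symm x)) • localForm β e x) := by
      filter_upwards [e.open_target.mem_nhds hu] with x hx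
      exact (isRandersPair_local he hx hF.norm_lt_one).smul (Real.exp_pos _)
    rw [localExpr_conformal_randers hF hF' e,
      douglasTensor_randersNorm_eq_zero_iff hpair ha.hasFDerivAt hb']
    constructor
    · intro h Y Z hY hZ
      have h1 := hext Y Z hY hZ
      rw [h, sub_self] at h1
      exact (mul_eq_zero.1 h1.symm).resolve_left (Real.exp_pos _).ne'
    · intro h v w
      -- The condition concerns global fields only, so arbitrary coordinate vectors `v`, `w` must be
      -- realized by such fields.
      obtain ⟨Y, hY, hYv⟩ := exists_isSmoothField_apply_eq (e.symm u) (chartDiff e u v)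
      obtain ⟨Z, hZ, hZw⟩ := exists_isSmoothField_apply_eq (e.symm u) (chartDiff e u w)
      have hinj := (isInvertible_chartDiff he hu).injective
      have hv : localField Y e u = v := hinj ((chartDiff_localField he hu Y).trans hYv)
      have hw : localField Z e u = w := hinj ((chartDiff_localField he hu Z).trans hZw)
      have h1 := hext Y Z hY hZ
      rw [h Y Z hY hZ, mul_zero, hv, hw] at h1
      exact sub_eq_zero.1 h1
  constructor
  · intro h Y Z hY hZ x
    have hx := (chartAt (EuclideanSpace ℝ (Fin n)) x).map_source (mem_chart_source _ x)
    have h1 := (key _ (IsManifold.chart_mem_maximalAtlas x) _ hx).1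
      (h.douglas_eq_zero _ (IsManifold.chart_mem_maximalAtlas x) _ hx) Y Z hY hZ
    rwa [(chartAt (EuclideanSpace ℝ (Fin n)) x).left_inv (mem_chart_source _ x)] at h1
  · intro h
    exact ⟨isFinslerMetric_conformal_randers hF hf hF', fun e he u hu =>
      (key e he u hu).2 fun Y Z hY hZ => h Y Z hY hZ _⟩
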